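/- **Notation.** Let $S_n$ be the symmetric group on $n$ letters, with the normalized Hamming metric $d(\sigma,\tau)=\frac1n|\{i:\sigma(i)\ne\tau(i)\}|$, and give $S_n^d$ the $\ell^1$-metric $\sum_i d(\sigma_i,\tau_i)$. For probability measures on $S_n^d$, let $d(\mu,\nu)$ be the Kantorovich–Rubinstein distance, i.e. the minimum of the expected distance over all couplings of $\mu$ and $\nu$. For $\mu\in P(S_n)$ let $\Sigma(\mu)$ be the average of $\mu$ over all conjugations by elements of $S_n$. A word with constants is an element $w$ of the free product $S_n*\mathbb F_r$, with reduced expression $c_0x_{\iota(1)}^{\varepsilon(1)}c_1\cdots x_{\iota(l)}^{\varepsilon(l)}c_l$ ($\varepsilon(j)=\pm1$, $c_j\in S_n$); its length is $l$, and its critical constants are the $c_j$ with $1\le j<l$, $\iota(j)=\iota(j+1)$ and $\varepsilon(j)=-\varepsilon(j+1)$; reduced means that no critical constant is central in $S_n$. The distribution of word values $\mu_w^{S_n}$ is the law of $w(\sigma_1,\dots,\sigma_r)$ for independent uniform $\sigma_i\in S_n$. The word $w$ is regular if it is not conjugate to an element of $S_n$ and all critical constants of $w^2$ are fixed point free. A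 tuple $(w_1,\dots,w_d)\in\mathbb F_r^d$ is simultaneously asymptotically equidistributed (s.a.e.) if the law of $(w_1(\sigma),\dots,w_d(\sigma))$, for uniform $\sigma\in S_n^r$, has Kantorovich–Rubinstein distance to the uniform measure on $S_n^d$ tending to $0$ as $n\to\infty$. **Conjecture.** For all $r$ and all sequences of regular words $w_n\in S_n*\mathbb F_r$ of bounded length, $\lim_{n\to\infty}d(\Sigma(\mu^{S_n}_{w_n}),\mu^{S_n}_{w_n})=0$. **Conjecture at long cycles** (a special case of the Conjecture). For every fixed $v=v(x,y)\in\mathbb F_2$ and all $n$-cycles $\sigma_n\in S_n$ such that $w_n:=v(\sigma_n,y)\in S_n*\mathbb F_1$ is regular for all large $n$, $\lim_{n\to\infty}d(\Sigma(\mu^{S_n}_{w_n}),\mu^{S_n}_{w_n})=0$. **Theorem.** Let $\mathbb F_2=\langle x,y\rangle$. 1. If the Conjecture holds, then the pair $(x,w(x,y))$ is s.a.e. for every $w\in\mathbb F_2\setminus\langle x\rangle$. 2. The same conclusion already holds if only the Conjecture at long cycles holds. -/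

import Mathlib

open Filter Topology

noncomputable section

namespace WordDist

/-! Words with constants -/

/-- A syllable `x_ι ^ ε · c`, with `ε = ± 1` and a constant `c` in the group `G`. -/
structure Syllable (G : Type) (r : ℕ) where
  var : Fin r
  sign : ℤˣ
  const : G

/-- A formal expression `c₀ x_{ι(1)}^{ε(1)} c₁ ⋯ x_{ι(l)}^{ε(l)} c_l`; the `j`-th syllable
carries `ι(j)`, `ε(j)` and the constant `c_j` that follows. -/
structure Expression (G : Type) (r : ℕ) where
  head : G
  syllables : List (Syllable G r)

/-- The free product `G ∗ F_r`, whose elements are the words with constants. -/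
abbrev ConstWord (G : Type) [Group G] (r : ℕ) : Type :=
  Monoid.Coprod G (FreeGroup (Fin r))

section

variable {G : Type} [Group G] {r : ℕ}

/-- The element `x_ι ^ ε · c` of the free product. -/
def Syllable.toWord (s : Syllable G r) : ConstWord G r :=
  Monoid.Coprod.inr (FreeGroup.of s.var ^ (s.sign : ℤ)) * Monoid.Coprod.inl s.const

/-- The element of the free product that is represented by an expression. -/
def Expression.toWord (e : Expression G r) : ConstWord G r :=
  Monoid.Coprod.inl e.head * (e.syllables.map Syllable.toWord).prod

/-- The number `l` of occurrences of variables. -/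
def Expression.length (e : Expression G r) : ℕ := e.syllables.length

/-- `e.IsCritical c`: the expression contains `x_i^ε c x_i^{-ε}`, that is, `c` is one of its
intermediate constants `c_j` with `ι(j) = ι(j+1)` and `ε(j) = -ε(j+1)`. -/
def Expression.IsCritical (e : Expression G r) (c : G) : Prop :=
  ∃ (j : ℕ) (hj : j + 1 < e.syllables.length),
    e.syllables[j].var = e.syllables[j + 1].var ∧
    e.syllables[j].sign = -e.syllables[j + 1].sign ∧
    c = e.syllables[j].const

/-- An expression is reduced if none of its critical constants is central. -/
def Expression.IsReduced (e : Expression G r) : Prop :=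
  ∀ c, e.IsCritical c → c ∉ Subgroup.center G

/-- The word with constants `w` has length at most `L`: it has a reduced expression with at most
`L` variables (the reduced expression of an element of the free product is unique). -/
def LengthLE (w : ConstWord G r) (L : ℕ) : Prop :=
  ∃ e : Expression G r, e.IsReduced ∧ e.toWord = w ∧ e.length ≤ L

/-- The word map `G ^ r → G`: evaluation at `g` of the unique homomorphism that is the identity on
`G` and sends `x_i` to `g_i`. -/
def evalAt (w : ConstWord G r) (g : Fin r → G) : G :=
  Monoid.Coprod.lift (MonoidHom.id G) (FreeGroup.lift g) w

/-- The distribution of word values of `w`: the push-forward of the normalized counting measure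
on `G ^ r` under the word map. -/
def wordValues [Fintype G] (w : ConstWord G r) : PMF G :=
  (PMF.uniformOfFintype (Fin r → G)).map (evalAt w)

/-- `Σ(μ)`, the average of the push-forwards of `μ` under all conjugations. -/
def conjAverage [Fintype G] (μ : PMF G) : PMF G :=
  (PMF.uniformOfFintype G).bind fun g => μ.map fun h => g * h * g⁻¹

end

/-- A word with constants in `S_n` is regular if it is not conjugate to a constant and all critical
constants of (the reduced expression of) `w ^ 2` are fixed point free. -/
def IsRegularWord {n r : ℕ} (w : ConstWord (Equiv.Perm (Fin n)) r) : Prop :=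
  (¬ ∃ c : Equiv.Perm (Fin n), IsConj w (Monoid.Coprod.inl c)) ∧
  ∃ e : Expression (Equiv.Perm (Fin n)) r, e.IsReduced ∧ e.toWord = w ^ 2 ∧
    ∀ c, e.IsCritical c → ∀ i, c i ≠ i

/-! Metrics -/

/-- The normalized Hamming metric on `S_n`. -/
def hamming {n : ℕ} (σ τ : Equiv.Perm (Fin n)) : ℝ :=
  (hammingDist (⇑σ) (⇑τ) : ℝ) / n

/-- The `ℓ¹`-product of the Hamming metrics on `S_n ^ d`. -/
def hammingTuple {n d : ℕ} (σ τ : Fin d → Equiv.Perm (Fin n)) : ℝ :=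
  ∑ i, hamming (σ i) (τ i)

/-- The Kantorovich-Rubinstein distance, with cost function `d`, of two probability measures on a
finite set: the infimum over all couplings `γ` of the expected cost (a minimum by compactness). -/
def krDist {α : Type} [Fintype α] (d : α → α → ℝ) (μ ν : PMF α) : ℝ :=
  sInf {t : ℝ | ∃ γ : PMF (α × α), γ.map Prod.fst = μ ∧ γ.map Prod.snd = ν ∧
    t = ∑ p : α × α, (γ p).toReal * d p.1 p.2}

/-! Asymptotic conjugation invariance -/

/-- For the sequence `w_n ∈ S_n ∗ F_r`, the Kantorovich-Rubinstein distance of the distribution of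
word values to its average over conjugations tends to `0`. -/
def AsympConjInvariant {r : ℕ} (w : (n : ℕ) → ConstWord (Equiv.Perm (Fin n)) r) : Prop :=
  Tendsto (fun n => krDist hamming (conjAverage (wordValues (w n))) (wordValues (w n)))
    atTop (𝓝 0)

/-- The conjecture: all sequences of regular words with constants of bounded length have
asymptotically conjugation invariant distributions of word values. -/
def ConjInvarianceConjecture : Prop :=
  ∀ (r : ℕ) (w : (n : ℕ) → ConstWord (Equiv.Perm (Fin n)) r),
    (∀ n, IsRegularWord (w n)) → (∃ L : ℕ, ∀ n, LengthLE (w n) L) → AsympConjInvariant w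

/-- For `v = v(x, y) ∈ F_2` and `σ ∈ G`, the word with constants `v(σ, y)` in the variable `y`. -/
def substFirst {G : Type} [Group G] (v : FreeGroup (Fin 2)) (σ : G) : ConstWord G 1 :=
  FreeGroup.lift ![Monoid.Coprod.inl σ, Monoid.Coprod.inr (FreeGroup.of 0)] v

/-- The special case of the conjecture for sequences `w_n = v(σ_n, y)`, where `v ∈ F_2` is fixed and
`σ_n` is an `n`-cycle, such that `w_n` is regular for all large `n` (the length of `w_n` is at most
that of `v`). -/
def ConjInvarianceAtLongCycles : Prop :=
  ∀ (v : FreeGroup (Fin 2)) (σ : (n : ℕ) → Equiv.Perm (Fin n)),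
    (∀ n, (σ n).IsCycleOn Set.univ) → (∀ᶠ n in atTop, IsRegularWord (substFirst v (σ n))) →
    AsympConjInvariant fun n => substFirst v (σ n)

/-! Simultaneous equidistribution -/

/-- A tuple of words `(w_1, …, w_d)` in `F_r` is simultaneously asymptotically equidistributed: the
joint distribution of the word values on `S_n ^ r` approaches the uniform distribution on `S_n ^ d`
in the Kantorovich-Rubinstein metric. -/
def IsSAE {d r : ℕ} (w : Fin d → FreeGroup (Fin r)) : Prop :=
  Tendsto (fun n : ℕ => krDist hammingTuple
    ((PMF.uniformOfFintype (Fin r → Equiv.Perm (Fin n))).map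
      fun g i => FreeGroup.lift g (w i))
    (PMF.uniformOfFintype (Fin d → Equiv.Perm (Fin n)))) atTop (𝓝 0)

end WordDist

end

/-! The proof conditions on the first letter and reduces to the case where it is a full cycle. A
typical permutation has few points on short cycles, so merging its cycles by transpositions changes
few values; word maps are Lipschitz in the Hamming metric, so the change costs little
(`exists_isCycleOn_univ_hamming_le`, `exists_hamming_lift_le`). It remains to show that `w(σ, τ)`,
for a full cycle `σ` and uniform `τ`, is nearly uniform, with an error independent of `σ`.

Multiplication by powers of `σ` on either side is an isometry that preserves the uniform measure.
Hence `w` may be replaced by a cyclically reduced word in its double coset of `⟨x⟩`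
(`exists_cycReducedList`). For large `n` the relevant powers of `σ` have no fixed points, so the
substituted word is regular (`isRegularWord_substFirst`), and either conjecture brings the law of
its values close to its conjugation average.

That average is computed by counting fixed points. Powers of a cyclically reduced word stay reduced,
and exposing `τ` one value at a time shows that a reduced path rarely closes up
(`card_path_mul_le`). Each fixed power of a random value thus has boundedly many fixed points on
average, so the value is close to a full cycle. Full cycles form a single conjugacy class, so the
conjugation average is close to the uniform measure on that class (`hasCoupling_conjAverage_cycle`).
The same holds for the word `yx`, whose values are exactly uniform; comparing the two gives the
claim. -/

noncomputable section

namespace WordDist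

/-! ### Expectations with respect to probability mass functions on finite types -/

section Mean

variable {α β : Type} [Fintype α] [Fintype β]

/-- The expectation of a real function under a probability mass function on a finite type. -/
def mean (μ : PMF α) (f : α → ℝ) : ℝ := ∑ x, (μ x).toReal * f x

lemma sum_toReal_eq_one (μ : PMF α) : ∑ x, (μ x).toReal = 1 := by
  rw [← ENNReal.toReal_sum fun x _ => μ.apply_ne_top x, ← tsum_fintype (L := .unconditional α),
    μ.tsum_coe, ENNReal.toReal_one]

lemma mean_bind (μ : PMF α) (k : α → PMF β) (f : β → ℝ) :
    mean (μ.bind k) f = mean μ fun x => mean (k x) f := by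
  have h : ∀ y, ((μ.bind k) y).toReal = ∑ x, (μ x).toReal * (k x y).toReal := by
    intro y
    rw [PMF.bind_apply, tsum_fintype, ENNReal.toReal_sum
      fun x _ => ENNReal.mul_ne_top (μ.apply_ne_top x) ((k x).apply_ne_top y)]
    simp only [ENNReal.toReal_mul]
  simp only [mean, h, Finset.sum_mul, Finset.mul_sum]
  rw [Finset.sum_comm]
  simp only [mul_assoc]

lemma mean_pure (a : α) (f : α → ℝ) : mean (PMF.pure a) f = f a := by
  classical
  rw [mean, Finset.sum_eq_single a]
  · simp
  · intro b _ hb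
    simp [hb]
  · simp

lemma mean_map (μ : PMF α) (g : α → β) (f : β → ℝ) :
    mean (μ.map g) f = mean μ fun x => f (g x) := by
  rw [PMF.map, mean_bind]
  simp only [Function.comp, mean_pure]

lemma mean_mono (μ : PMF α) {f g : α → ℝ} (h : ∀ x, f x ≤ g x) : mean μ f ≤ mean μ g :=
  Finset.sum_le_sum fun x _ => mul_le_mul_of_nonneg_left (h x) ENNReal.toReal_nonneg

lemma mean_const (μ : PMF α) (t : ℝ) : mean μ (fun _ => t) = t := by
  rw [mean, ← Finset.sum_mul, sum_toReal_eq_one, one_mul]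

lemma mean_add (μ : PMF α) (f g : α → ℝ) :
    mean μ (fun x => f x + g x) = mean μ f + mean μ g := by
  simp only [mean, mul_add, Finset.sum_add_distrib]

lemma mean_const_mul (μ : PMF α) (t : ℝ) (f : α → ℝ) :
    mean μ (fun x => t * f x) = t * mean μ f := by
  simp only [mean, Finset.mul_sum]
  exact Finset.sum_congr rfl fun x _ => by ring

lemma mean_sum {ι : Type} (s : Finset ι) (μ : PMF α) (f : ι → α → ℝ) :
    mean μ (fun x => ∑ i ∈ s, f i x) = ∑ i ∈ s, mean μ (f i) := by
  simp only [mean, Finset.mul_sum]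
  exact Finset.sum_comm

lemma mean_nonneg (μ : PMF α) {f : α → ℝ} (h : ∀ x, 0 ≤ f x) : 0 ≤ mean μ f :=
  Finset.sum_nonneg fun x _ => mul_nonneg ENNReal.toReal_nonneg (h x)

lemma mean_uniform [Nonempty α] (f : α → ℝ) :
    mean (PMF.uniformOfFintype α) f = (∑ x, f x) / Fintype.card α := by
  simp [mean, div_eq_inv_mul, Finset.mul_sum]

end Mean

/-! ### Uniform distributions -/

lemma uniformOfFintype_map_equiv {α β : Type} [Fintype α] [Fintype β] [Nonempty α] [Nonempty β]
    (e : α ≃ β) : (PMF.uniformOfFintype α).map e = PMF.uniformOfFintype β := by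
  classical
  ext b
  rw [PMF.map_apply, tsum_eq_single (e.symm b)]
  · simp [Fintype.card_congr e]
  · intro a ha
    rw [if_neg]
    rintro rfl
    simp at ha

lemma uniformOfFintype_prod {α β : Type} [Fintype α] [Fintype β] [Nonempty α] [Nonempty β] :
    PMF.uniformOfFintype (α × β) = (PMF.uniformOfFintype α).bind
      fun a => (PMF.uniformOfFintype β).map fun b => (a, b) := by
  classical
  ext ⟨a, b⟩
  rw [PMF.bind_apply, tsum_eq_single a, PMF.map_apply, tsum_eq_single b]
  · simp [ENNReal.mul_inv]
  · intro b' hb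
    rw [if_neg]
    simpa using hb.symm
  · intro a' ha
    rw [PMF.map_apply]
    simp [ha.symm]

lemma map_const_fun {α β : Type} (p : PMF α) (b : β) : p.map (fun _ => b) = PMF.pure b :=
  PMF.map_const p b

/-! ### Couplings -/

section Coupling

variable {α β : Type} [Fintype α] [Fintype β]

/-- Two probability mass functions have a coupling of expected cost at most `t`. -/
def HasCoupling (d : α → α → ℝ) (μ ν : PMF α) (t : ℝ) : Prop :=
  ∃ γ : PMF (α × α), γ.map Prod.fst = μ ∧ γ.map Prod.snd = ν ∧
    mean γ (fun p => d p.1 p.2) ≤ t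

lemma HasCoupling.mono {d : α → α → ℝ} {μ ν : PMF α} {s t : ℝ} (h : HasCoupling d μ ν s)
    (hst : s ≤ t) : HasCoupling d μ ν t := by
  obtain ⟨γ, h1, h2, h3⟩ := h
  exact ⟨γ, h1, h2, h3.trans hst⟩

lemma HasCoupling.symm {d : α → α → ℝ} (hd : ∀ a b, d a b = d b a) {μ ν : PMF α} {t : ℝ}
    (h : HasCoupling d μ ν t) : HasCoupling d ν μ t := by
  obtain ⟨γ, h1, h2, h3⟩ := h
  refine ⟨γ.map Prod.swap, ?_, ?_, ?_⟩
  · rw [PMF.map_comp, ← h2]; rfl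
  · rw [PMF.map_comp, ← h1]; rfl
  · rw [mean_map]
    simpa only [Prod.fst_swap, Prod.snd_swap, hd] using
      (mean_mono γ fun p => (hd p.2 p.1).le).trans h3

lemma HasCoupling.map_map (p : PMF β) (d : α → α → ℝ) (f g : β → α) {t : ℝ}
    (h : ∀ x, d (f x) (g x) ≤ t) : HasCoupling d (p.map f) (p.map g) t := by
  refine ⟨p.map fun x => (f x, g x), ?_, ?_, ?_⟩
  · rw [PMF.map_comp]; rfl
  · rw [PMF.map_comp]; rfl
  · rw [mean_map]
    exact (mean_mono p h).trans (mean_const p t).le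

lemma HasCoupling.map {d : α → α → ℝ} {d' : β → β → ℝ} {μ ν : PMF α} {t : ℝ}
    (h : HasCoupling d μ ν t) (f : α → β) (hf : ∀ a b, d' (f a) (f b) ≤ d a b) :
    HasCoupling d' (μ.map f) (ν.map f) t := by
  obtain ⟨γ, rfl, rfl, h3⟩ := h
  refine ⟨γ.map (Prod.map f f), ?_, ?_, ?_⟩
  · rw [PMF.map_comp, PMF.map_comp]; rfl
  · rw [PMF.map_comp, PMF.map_comp]; rfl
  · rw [mean_map]
    exact (mean_mono γ fun p => hf p.1 p.2).trans h3

lemma HasCoupling.bind (p : PMF β) (d : α → α → ℝ) (k l : β → PMF α) (t : β → ℝ)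
    (h : ∀ x, HasCoupling d (k x) (l x) (t x)) :
    HasCoupling d (p.bind k) (p.bind l) (mean p t) := by
  choose γ h1 h2 h3 using h
  refine ⟨p.bind γ, ?_, ?_, ?_⟩
  · rw [PMF.map_bind]; simp only [h1]
  · rw [PMF.map_bind]; simp only [h2]
  · rw [mean_bind]
    exact mean_mono p h3

/-- Disintegration of a distribution on a product along the first marginal. -/
lemma exists_disintegration {γ : Type} [Fintype γ] (ζ : PMF (β × γ)) :
    ∃ k : β → PMF γ, (ζ.map Prod.fst).bind (fun b => (k b).map fun c => (b, c)) = ζ := by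
  classical
  have hsum : ∀ b, ∑ c, ζ (b, c) = (ζ.map Prod.fst) b := by
    intro b
    rw [PMF.map_apply, tsum_fintype, Fintype.sum_prod_type, Finset.sum_eq_single b]
    · simp
    · intro b' _ hb
      exact Finset.sum_eq_zero fun c _ => if_neg hb.symm
    · simp
  obtain ⟨⟨b₀, c₀⟩, -⟩ := ζ.support_nonempty
  -- On fibres of mass zero the conditional law is arbitrary; a point mass serves.
  refine ⟨fun b => if h : ∑' c, ζ (b, c) = 0 then PMF.pure c₀ else
    PMF.normalize (fun c => ζ (b, c)) h ?_, ?_⟩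
  · rw [tsum_fintype, hsum]
    exact PMF.apply_ne_top _ _
  · ext ⟨b, c⟩
    rw [PMF.bind_apply, tsum_eq_single b]
    · by_cases h : ∑' c, ζ (b, c) = 0
      · rw [tsum_fintype, hsum] at h
        rw [h, zero_mul]
        rw [← hsum, Finset.sum_eq_zero_iff] at h
        exact (h c (Finset.mem_univ c)).symm
      · have h' : (ζ.map Prod.fst) b ≠ 0 := by
          rwa [← hsum, ← tsum_fintype (L := .unconditional γ)]
        beta_reduce
        rw [dif_neg h, PMF.map_apply _ (PMF.normalize _ _ _), tsum_eq_single c]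
        · rw [if_pos rfl, PMF.normalize_apply, tsum_fintype, hsum,
            mul_comm, mul_assoc, ENNReal.inv_mul_cancel h' (PMF.apply_ne_top _ _), mul_one]
        · intro c' hc
          rw [if_neg]
          simpa using hc.symm
    · intro b' hb
      rw [PMF.map_apply]
      simp [hb.symm]

/-- Gluing of couplings: the second one is disintegrated over the common marginal `ν`, and its third
point is drawn conditionally on the middle one. -/
lemma HasCoupling.trans {d : α → α → ℝ} (hd : ∀ a b c, d a c ≤ d a b + d b c) {μ ν ρ : PMF α}
    {s t : ℝ} (h : HasCoupling d μ ν s) (h' : HasCoupling d ν ρ t) :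
    HasCoupling d μ ρ (s + t) := by
  obtain ⟨γ, rfl, h2, h3⟩ := h
  obtain ⟨ζ, h4, rfl, h6⟩ := h'
  obtain ⟨k, hk⟩ := exists_disintegration ζ
  set θ : PMF ((α × α) × α) := γ.bind fun p => (k p.2).map fun c => (p, c) with hθ
  have h12 : θ.map Prod.fst = γ := by
    rw [hθ, PMF.map_bind]
    simp only [PMF.map_comp, Function.comp_def, map_const_fun, PMF.bind_pure]
  have h23 : θ.map (fun q => (q.1.2, q.2)) = ζ := by
    rw [← hk, h4, ← h2, hθ, PMF.map_bind, PMF.bind_map]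
    simp only [PMF.map_comp, Function.comp_def]
  refine ⟨θ.map fun q => (q.1.1, q.2), ?_, ?_, ?_⟩
  · rw [← h12, PMF.map_comp, PMF.map_comp]; rfl
  · rw [← h23, PMF.map_comp, PMF.map_comp]; rfl
  · rw [← h12, mean_map] at h3
    rw [← h23, mean_map] at h6
    rw [mean_map]
    refine (mean_mono θ fun q => hd q.1.1 q.1.2 q.2).trans ?_
    rw [mean_add]
    exact add_le_add h3 h6

lemma HasCoupling.krDist_le {d : α → α → ℝ} (hd : ∀ a b, 0 ≤ d a b) {μ ν : PMF α} {t : ℝ}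
    (h : HasCoupling d μ ν t) : krDist d μ ν ≤ t := by
  obtain ⟨γ, h1, h2, h3⟩ := h
  refine le_trans (csInf_le ⟨0, ?_⟩ ?_) h3
  swap
  · exact ⟨γ, h1, h2, rfl⟩
  rintro _ ⟨γ, -, -, rfl⟩
  exact mean_nonneg γ fun p => hd p.1 p.2

lemma krDist_nonneg {d : α → α → ℝ} (hd : ∀ a b, 0 ≤ d a b) (μ ν : PMF α) :
    0 ≤ krDist d μ ν := by
  refine Real.sInf_nonneg ?_
  rintro _ ⟨γ, -, -, rfl⟩
  exact mean_nonneg γ fun p => hd p.1 p.2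

/-- The strict inequality avoids showing that the infimum is attained. The product coupling ensures
that the infimum is not over the empty set. -/
lemma hasCoupling_of_krDist_lt {d : α → α → ℝ} {μ ν : PMF α} {t : ℝ}
    (h : krDist d μ ν < t) : HasCoupling d μ ν t := by
  have hne : {t : ℝ | ∃ γ : PMF (α × α), γ.map Prod.fst = μ ∧ γ.map Prod.snd = ν ∧
      t = ∑ p : α × α, (γ p).toReal * d p.1 p.2}.Nonempty := by
    refine ⟨_, μ.bind fun a => ν.map fun b => (a, b), ?_, ?_, rfl⟩
    · rw [PMF.map_bind]
      simp only [PMF.map_comp, Function.comp_def, map_const_fun, PMF.bind_pure]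
    · rw [PMF.map_bind]
      simp only [PMF.map_comp, Function.comp_def, PMF.bind_const]
      exact PMF.map_id ν
  obtain ⟨_, ⟨γ, h1, h2, rfl⟩, h3⟩ := exists_lt_of_csInf_lt hne h
  exact ⟨γ, h1, h2, h3.le⟩

end Coupling

/-! ### The Hamming metric -/

section Hamming

variable {n : ℕ}

lemma hamming_nonneg (σ τ : Equiv.Perm (Fin n)) : 0 ≤ hamming σ τ := by
  unfold hamming; positivity

lemma hamming_self (σ : Equiv.Perm (Fin n)) : hamming σ σ = 0 := by
  simp [hamming]

lemma hamming_comm (σ τ : Equiv.Perm (Fin n)) : hamming σ τ = hamming τ σ := by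
  rw [hamming, hamming, hammingDist_comm]

lemma hamming_triangle (σ τ ρ : Equiv.Perm (Fin n)) :
    hamming σ ρ ≤ hamming σ τ + hamming τ ρ := by
  rw [hamming, hamming, hamming, ← add_div]
  gcongr
  exact_mod_cast hammingDist_triangle _ _ _

lemma hamming_mul_left (g σ τ : Equiv.Perm (Fin n)) :
    hamming (g * σ) (g * τ) = hamming σ τ := by
  simp [hamming, hammingDist]

lemma hamming_mul_right (g σ τ : Equiv.Perm (Fin n)) :
    hamming (σ * g) (τ * g) = hamming σ τ := by
  unfold hamming hammingDist
  congr 2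
  exact Finset.card_equiv g fun i => by
    rw [Finset.mem_filter, Finset.mem_filter]
    simp

lemma hamming_conj (g σ τ : Equiv.Perm (Fin n)) :
    hamming (g * σ * g⁻¹) (g * τ * g⁻¹) = hamming σ τ := by
  rw [hamming_mul_right, hamming_mul_left]

lemma hamming_mul_le (σ σ' τ τ' : Equiv.Perm (Fin n)) :
    hamming (σ * τ) (σ' * τ') ≤ hamming σ σ' + hamming τ τ' := by
  refine (hamming_triangle _ (σ' * τ) _).trans ?_
  rw [hamming_mul_right, hamming_mul_left]

lemma hamming_inv (σ τ : Equiv.Perm (Fin n)) : hamming σ⁻¹ τ⁻¹ = hamming σ τ := by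
  rw [← hamming_mul_left σ, ← hamming_mul_right τ]
  simp [hamming_comm]

lemma hamming_mul_swap_le (σ : Equiv.Perm (Fin n)) (x y : Fin n) :
    hammingDist (⇑σ) (⇑(σ * Equiv.swap x y)) ≤ 2 := by
  unfold hammingDist
  refine (Finset.card_le_card (t := {x, y}) ?_).trans Finset.card_le_two
  intro z hz
  by_contra h
  simp only [Finset.mem_insert, Finset.mem_singleton, not_or] at h
  simp [Equiv.swap_apply_of_ne_of_ne h.1 h.2] at hz

end Hamming

/-! ### Merging cycles -/

section Merge

variable {α : Type} [DecidableEq α]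

/-- The new permutation sends `x` to `π y` and then follows the `π`-orbit of `y`, which never meets
`x`, until it returns to `y`. -/
lemma sameCycle_mul_swap [Finite α] {π : Equiv.Perm α} {x y : α} (h : ¬ π.SameCycle x y) :
    (π * Equiv.swap x y).SameCycle x y := by
  set τ := π * Equiv.swap x y with hτ
  by_contra hc
  have key : ∀ j : ℕ, τ.SameCycle x ((π ^ (j + 1)) y) := by
    intro j
    induction j with
    | zero =>
      have : τ x = π y := by simp [hτ]
      rw [zero_add, pow_one, ← this]
      exact Equiv.Perm.sameCycle_apply_right.2 (Equiv.Perm.SameCycle.refl _ _)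
    | succ j ih =>
      have hx : (π ^ (j + 1)) y ≠ x := by
        intro hx
        exact h (Equiv.Perm.SameCycle.symm ⟨(j + 1 : ℕ), by rw [zpow_natCast]; exact hx⟩)
      have hy : (π ^ (j + 1)) y ≠ y := by
        intro hy
        rw [hy] at ih
        exact hc ih
      have : τ ((π ^ (j + 1)) y) = (π ^ (j + 1 + 1)) y := by
        rw [hτ, Equiv.Perm.mul_apply, Equiv.swap_apply_of_ne_of_ne hx hy, pow_succ' π (j + 1),
          Equiv.Perm.mul_apply]
      rw [← this]
      exact Equiv.Perm.sameCycle_apply_right.2 ih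
  have := key (orderOf π - 1)
  rw [Nat.sub_add_cancel (orderOf_pos π), pow_orderOf_eq_one] at this
  exact hc this

lemma SameCycle.mul_swap [Finite α] {π : Equiv.Perm α} {x y u v : α} (h : ¬ π.SameCycle x y)
    (huv : π.SameCycle u v) : (π * Equiv.swap x y).SameCycle u v := by
  have hxy := sameCycle_mul_swap h
  set τ := π * Equiv.swap x y with hτ
  have step : ∀ z, τ.SameCycle z (π z) := by
    intro z
    by_cases hx : z = x
    · subst hx
      have : τ y = π z := by simp [hτ]
      rw [← this]
      exact Equiv.Perm.sameCycle_apply_right.2 hxy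
    · by_cases hy : z = y
      · subst hy
        have : τ x = π z := by simp [hτ]
        rw [← this]
        exact Equiv.Perm.sameCycle_apply_right.2 hxy.symm
      · have : τ z = π z := by
          rw [hτ, Equiv.Perm.mul_apply, Equiv.swap_apply_of_ne_of_ne hx hy]
        rw [← this]
        exact Equiv.Perm.sameCycle_apply_right.2 (Equiv.Perm.SameCycle.refl _ _)
  obtain ⟨k, rfl⟩ := huv.exists_nat_pow_eq
  clear huv
  induction k with
  | zero => exact Equiv.Perm.SameCycle.refl _ _
  | succ k ih =>
    rw [pow_succ', Equiv.Perm.mul_apply]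
    exact ih.trans (step _)

/-- A permutation of which `R` meets every cycle is close to a full cycle. -/
lemma exists_isCycleOn_univ_near {n : ℕ} (R : Finset (Fin n)) (π : Equiv.Perm (Fin n))
    (hR : ∀ x, ∃ r ∈ R, π.SameCycle r x) :
    ∃ π' : Equiv.Perm (Fin n), π'.IsCycleOn Set.univ ∧ hammingDist ⇑π ⇑π' ≤ 2 * R.card := by
  induction hk : R.card generalizing R π with
  | zero =>
    refine ⟨π, ⟨Set.bijOn_univ.2 π.bijective, fun x => ?_⟩, by simp⟩
    obtain ⟨r, hr, -⟩ := hR x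
    simp [Finset.card_eq_zero.1 hk] at hr
  | succ k ih =>
    by_cases hall : ∀ x ∈ R, ∀ y ∈ R, π.SameCycle x y
    · refine ⟨π, ⟨Set.bijOn_univ.2 π.bijective, fun x _ y _ => ?_⟩, by simp⟩
      obtain ⟨r, hr, hrx⟩ := hR x
      obtain ⟨s, hs, hsy⟩ := hR y
      exact hrx.symm.trans ((hall r hr s hs).trans hsy)
    · push Not at hall
      obtain ⟨x, hx, y, hy, hxy⟩ := hall
      have hne : x ≠ y := by
        rintro rfl
        exact hxy (Equiv.Perm.SameCycle.refl _ _)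
      -- The transposition joins the cycles of `x` and `y`, so `x` now represents both and `y` can
      -- be dropped, at the cost of two changed values.
      obtain ⟨π', h1, h2⟩ := ih (R.erase y) (π * Equiv.swap x y) (fun z => by
        obtain ⟨r, hr, hrz⟩ := hR z
        by_cases hry : r = y
        · subst hry
          exact ⟨x, Finset.mem_erase.2 ⟨hne, hx⟩,
            (sameCycle_mul_swap hxy).trans (SameCycle.mul_swap hxy hrz)⟩
        · exact ⟨r, Finset.mem_erase.2 ⟨hry, hr⟩, SameCycle.mul_swap hxy hrz⟩)
        (by rw [Finset.card_erase_of_mem hy, hk]; rfl)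
      refine ⟨π', h1, (hammingDist_triangle _ (⇑(π * Equiv.swap x y)) _).trans ?_⟩
      have := hamming_mul_swap_le π x y
      omega

/-- The points on cycles of length less than `K`, and one point on each of the other cycles, form
a set that meets every cycle. -/
lemma exists_transversal [Fintype α] (π : Equiv.Perm α) (K : ℕ) :
    ∃ R : Finset α, (∀ x, ∃ r ∈ R, π.SameCycle r x) ∧
      K * R.card ≤ Fintype.card α +
        K * ∑ k ∈ Finset.range K, (Finset.univ.filter fun x => (π ^ (k + 1)) x = x).card := by
  classical
  set S : Finset α := (Finset.range K).biUnion
    fun k => Finset.univ.filter fun x => (π ^ (k + 1)) x = x with hS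
  let f : α → α := fun x => Quotient.out (Quotient.mk (Equiv.Perm.SameCycle.setoid π) x)
  have hf : ∀ x, π.SameCycle (f x) x := fun x =>
    Quotient.exact (s := Equiv.Perm.SameCycle.setoid π) (Quotient.out_eq _)
  have hfeq : ∀ x y, π.SameCycle x y → f x = f y := fun x y h => by
    have : Quotient.mk (Equiv.Perm.SameCycle.setoid π) x = Quotient.mk _ y := Quotient.sound h
    simp only [f, this]
  refine ⟨S ∪ Sᶜ.image f, fun x => ?_, ?_⟩
  · by_cases hx : x ∈ S
    · exact ⟨x, Finset.mem_union_left _ hx, Equiv.Perm.SameCycle.refl _ _⟩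
    · exact ⟨f x, Finset.mem_union_right _
        (Finset.mem_image_of_mem f (Finset.mem_compl.2 hx)), hf x⟩
  · have h1 : K * (Sᶜ.image f).card ≤ Sᶜ.card := by
      refine Finset.mul_card_image_le_card _ K fun a ha => ?_
      obtain ⟨x, hx, rfl⟩ := Finset.mem_image.1 ha
      rw [Finset.mem_compl] at hx
      have hx' : ∀ k < K, (π ^ (k + 1)) x ≠ x := by
        intro k hk h
        exact hx (Finset.mem_biUnion.2 ⟨k, Finset.mem_range.2 hk, by simpa using h⟩)
      rw [← Finset.card_range K]
      refine Finset.card_le_card_of_injOn (fun k => (π ^ k) x) ?_ ?_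
      · intro k hk
        simp only [Finset.coe_filter, Finset.mem_compl, Set.mem_ofPred_eq]
        refine ⟨fun h => ?_, hfeq _ _ (Equiv.Perm.SameCycle.symm ⟨k, by simp⟩)⟩
        obtain ⟨j, hj, h⟩ := Finset.mem_biUnion.1 h
        refine hx' j (Finset.mem_range.1 hj) ?_
        have h := (Finset.mem_filter.1 h).2
        rw [← Equiv.Perm.mul_apply, ← pow_add, add_comm, pow_add, Equiv.Perm.mul_apply] at h
        exact (π ^ k).injective h
      · have aux : ∀ i j : ℕ, i < j → j < K → (π ^ i) x ≠ (π ^ j) x := by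
          intro i j hij hj h
          obtain ⟨m, rfl⟩ := Nat.exists_eq_add_of_lt hij
          rw [add_assoc, pow_add, Equiv.Perm.mul_apply] at h
          exact hx' m (by omega) ((π ^ i).injective h).symm
        intro i hi j hj h
        rcases lt_trichotomy i j with hij | hij | hij
        · exact absurd h (aux i j hij (by simpa using hj))
        · exact hij
        · exact absurd h.symm (aux j i hij (by simpa using hi))
    have h2 := Finset.card_biUnion_le (s := Finset.range K)
      (t := fun k => Finset.univ.filter fun x => (π ^ (k + 1)) x = x)
    have h3 := Finset.card_union_le S (Sᶜ.image f)
    have h4 := Finset.card_le_univ Sᶜ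
    calc K * (S ∪ Sᶜ.image f).card ≤ K * (S.card + (Sᶜ.image f).card) := by gcongr
      _ = K * (Sᶜ.image f).card + K * S.card := by ring
      _ ≤ _ := add_le_add (h1.trans h4) (Nat.mul_le_mul_left K h2)

end Merge

/-- The number of fixed points. -/
def fixCount {α : Type} [Fintype α] [DecidableEq α] (π : Equiv.Perm α) : ℕ :=
  (Finset.univ.filter fun x => π x = x).card

/-- Long cycles number at most `n / K`, and points on short cycles are fixed by one of the first `K`
positive powers. Each chosen representative costs at most two values. -/
lemma exists_isCycleOn_univ_hamming_le {n K : ℕ} (hn : 0 < n) (hK : 0 < K)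
    (π : Equiv.Perm (Fin n)) :
    ∃ π' : Equiv.Perm (Fin n), π'.IsCycleOn Set.univ ∧
      hamming π π' ≤ 2 / K + 2 / n * ∑ k ∈ Finset.range K, (fixCount (π ^ (k + 1)) : ℝ) := by
  obtain ⟨R, hR, hc⟩ := exists_transversal π K
  obtain ⟨π', h1, h2⟩ := exists_isCycleOn_univ_near R π hR
  refine ⟨π', h1, ?_⟩
  rw [Fintype.card_fin] at hc
  have hc' : (K : ℝ) * R.card ≤ n + K * ∑ k ∈ Finset.range K, (fixCount (π ^ (k + 1)) : ℝ) := by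
    exact_mod_cast hc
  have h2' : (hammingDist ⇑π ⇑π' : ℝ) ≤ 2 * R.card := by exact_mod_cast h2
  have hn' : (0 : ℝ) < n := by exact_mod_cast hn
  have hK' : (0 : ℝ) < K := by exact_mod_cast hK
  set F := ∑ k ∈ Finset.range K, (fixCount (π ^ (k + 1)) : ℝ)
  rw [hamming, div_le_iff₀ hn']
  have : (2 / K + 2 / n * F) * n = 2 * ((n + K * F) / K) := by
    field_simp
  rw [this]
  refine h2'.trans ?_
  gcongr
  rw [le_div_iff₀ hK']
  linarith

lemma isConj_of_isCycleOn_univ {n : ℕ} {σ τ : Equiv.Perm (Fin n)}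
    (hσ : σ.IsCycleOn Set.univ) (hτ : τ.IsCycleOn Set.univ) : ∃ g, g * σ * g⁻¹ = τ := by
  rcases Nat.lt_or_ge n 2 with hn | hn
  · have : Subsingleton (Fin n) := Fin.subsingleton_iff_le_one.2 (by omega)
    exact ⟨1, Subsingleton.elim _ _⟩
  · have : Nontrivial (Fin n) := Fin.nontrivial_iff_two_le.2 hn
    have key : ∀ {ρ : Equiv.Perm (Fin n)}, ρ.IsCycleOn Set.univ →
        ρ.IsCycle ∧ ρ.support = Finset.univ := by
      intro ρ hρ
      have h : ∀ x, ρ x ≠ x := fun x => hρ.apply_ne Set.nontrivial_univ (Set.mem_univ x)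
      refine ⟨⟨⟨0, by omega⟩, h _, fun y _ => hρ.2 (Set.mem_univ _) (Set.mem_univ _)⟩, ?_⟩
      ext x
      simpa using h x
    have h := (key hσ).1.isConj (key hτ).1 (by rw [(key hσ).2, (key hτ).2])
    exact isConj_iff.1 h

lemma exists_isCycleOn_univ (n : ℕ) : ∃ σ : Equiv.Perm (Fin n), σ.IsCycleOn Set.univ := by
  rcases Nat.lt_or_ge n 2 with hn | hn
  · have : Subsingleton (Fin n) := Fin.subsingleton_iff_le_one.2 (by omega)
    exact ⟨1, Set.bijOn_univ.2 (Equiv.bijective _),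
      fun x _ y _ => by rw [Subsingleton.elim x y]⟩
  · have h := isCycle_finRotate_of_le hn
    refine ⟨finRotate n, Set.bijOn_univ.2 (Equiv.bijective _), fun x _ y _ => ?_⟩
    have hs := support_finRotate_of_le hn
    have hx : ∀ x, finRotate n x ≠ x := fun x => Equiv.Perm.mem_support.1 (by simp [hs])
    exact h.sameCycle (hx x) (hx y)

/-! ### Distributions that are invariant under conjugation -/

section Conj

variable {n : ℕ}

/-- The uniform distribution on the conjugacy class of a group element. -/
def conjUniform {G : Type} [Group G] [Fintype G] (h : G) : PMF G :=
  (PMF.uniformOfFintype G).map fun g => g * h * g⁻¹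

/-- Exchanging the order of averaging turns `Σ(μ)` into a mixture of uniform measures on conjugacy
classes, which can be coupled class by class. -/
lemma conjAverage_eq {G : Type} [Group G] [Fintype G] (μ : PMF G) :
    conjAverage μ = μ.bind conjUniform := by
  unfold conjAverage conjUniform PMF.map
  rw [PMF.bind_comm]
  rfl

lemma conjUniform_conj {G : Type} [Group G] [Fintype G] (g h : G) :
    conjUniform (g * h * g⁻¹) = conjUniform h := by
  unfold conjUniform
  conv_rhs => rw [← uniformOfFintype_map_equiv (Equiv.mulRight g), PMF.map_comp]
  congr 1
  funext k
  simp [mul_assoc]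

lemma conjAverage_uniform {G : Type} [Group G] [Fintype G] :
    conjAverage (PMF.uniformOfFintype G) = PMF.uniformOfFintype G := by
  unfold conjAverage
  have : ∀ g : G, (PMF.uniformOfFintype G).map (fun h => g * h * g⁻¹) =
      PMF.uniformOfFintype G := fun g =>
    uniformOfFintype_map_equiv (MulAut.conj g).toEquiv
  simp only [this, PMF.bind_const]

/-- The conjugation average of a distribution is close to the uniform distribution on the full
cycles if there are few fixed points of small powers on average. -/
lemma hasCoupling_conjAverage_cycle {K : ℕ} (hn : 0 < n) (hK : 0 < K)
    (μ : PMF (Equiv.Perm (Fin n))) {ζ : Equiv.Perm (Fin n)} (hζ : ζ.IsCycleOn Set.univ) :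
    HasCoupling hamming (conjAverage μ) (conjUniform ζ)
      (2 / K + 2 / n * ∑ k ∈ Finset.range K, mean μ fun π => (fixCount (π ^ (k + 1)) : ℝ)) := by
  choose c hc hd using exists_isCycleOn_univ_hamming_le hn hK
  -- As all full cycles are conjugate, the target is also a mixture with weights `μ`; the two
  -- mixtures are then coupled by a common conjugator.
  have h : conjUniform ζ = μ.bind fun π => conjUniform (c π) := by
    have : ∀ π, conjUniform (c π) = conjUniform ζ := fun π => by
      obtain ⟨g, hg⟩ := isConj_of_isCycleOn_univ hζ (hc π)
      rw [← hg, conjUniform_conj]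
    simp only [this, PMF.bind_const]
  rw [h, conjAverage_eq]
  refine (HasCoupling.bind μ hamming conjUniform (fun π => conjUniform (c π))
    (fun π => hamming π (c π)) fun π => ?_).mono ((mean_mono μ hd).trans ?_)
  · exact HasCoupling.map_map _ _ _ _ fun g => (hamming_conj g _ _).le
  · rw [mean_add, mean_const, mean_const_mul, mean_sum]

end Conj

/-! ### Words in two letters -/

/-- The word `∏ y ^ ε * x ^ a` of a list of pairs `(ε, a)`. -/
def listWord {G : Type} [Group G] (x y : G) (L : List (ℤˣ × ℤ)) : G :=
  (L.map fun s => y ^ (s.1 : ℤ) * x ^ s.2).prod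

section ListWord

variable {G H : Type} [Group G] [Group H]

@[simp] lemma listWord_nil (x y : G) : listWord x y [] = 1 := rfl

@[simp] lemma listWord_cons (x y : G) (s : ℤˣ × ℤ) (L : List (ℤˣ × ℤ)) :
    listWord x y (s :: L) = y ^ (s.1 : ℤ) * x ^ s.2 * listWord x y L := by
  simp [listWord]

lemma listWord_append (x y : G) (L M : List (ℤˣ × ℤ)) :
    listWord x y (L ++ M) = listWord x y L * listWord x y M := by
  simp [listWord]

lemma listWord_flatten_replicate (x y : G) (L : List (ℤˣ × ℤ)) (k : ℕ) :
    listWord x y (List.replicate k L).flatten = listWord x y L ^ k := by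
  induction k with
  | zero => simp
  | succ k ih => rw [List.replicate_succ, List.flatten_cons, listWord_append, ih, pow_succ']

lemma map_listWord (f : G →* H) (x y : G) (L : List (ℤˣ × ℤ)) :
    f (listWord x y L) = listWord (f x) (f y) L := by
  induction L with
  | nil => simp
  | cons s L ih => simp [ih]

end ListWord

/-- A list of pairs `(ε, a)` gives a reduced word. -/
def ReducedList (L : List (ℤˣ × ℤ)) : Prop :=
  L.IsChain fun s t => s.2 = 0 → s.1 = t.1

/-- A list of pairs `(ε, a)` gives a cyclically reduced word that ends in a power of `x`. -/
def CycReducedList (L : List (ℤˣ × ℤ)) : Prop :=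
  ReducedList L ∧ ∀ s ∈ L.getLast?, s.2 ≠ 0

/-- The nonzero last exponent of `L` rules out cancellation at the seam. -/
lemma CycReducedList.append {L M : List (ℤˣ × ℤ)} (hL : CycReducedList L)
    (hM : ReducedList M) : ReducedList (L ++ M) := by
  refine List.isChain_append.2 ⟨hL.1, hM, fun s hs t _ h => absurd h (hL.2 s hs)⟩

lemma CycReducedList.flatten_replicate {L : List (ℤˣ × ℤ)} (hL : CycReducedList L) (k : ℕ) :
    ReducedList (List.replicate k L).flatten := by
  induction k with
  | zero => exact List.isChain_nil
  | succ k ih =>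
    rw [List.replicate_succ, List.flatten_cons]
    exact hL.append ih

/-! ### Fixed points of random word values -/

section Count

variable {α : Type} [Fintype α] [DecidableEq α]

/-- The permutations that extend a finite set of prescribed values. -/
def extensions (D : List (α × α)) : Finset (Equiv.Perm α) :=
  Finset.univ.filter fun τ => ∀ d ∈ D, τ d.1 = d.2

lemma mem_extensions {D : List (α × α)} {τ : Equiv.Perm α} :
    τ ∈ extensions D ↔ ∀ d ∈ D, τ d.1 = d.2 := by
  simp [extensions]

lemma card_extensions_swap (D : List (α × α)) :
    (extensions (D.map Prod.swap)).card = (extensions D).card := by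
  refine Finset.card_equiv (Equiv.inv _) fun τ => ?_
  simp only [mem_extensions, List.mem_map, Prod.exists, Equiv.inv_apply]
  constructor
  · intro h d hd
    rw [Equiv.Perm.inv_eq_iff_eq]
    exact (h (d.2, d.1) ⟨d.1, d.2, hd, rfl⟩).symm
  · rintro h _ ⟨a, b, hd, rfl⟩
    have := h (a, b) hd
    rw [Equiv.Perm.inv_eq_iff_eq] at this
    exact this.symm

/-- A newly exposed value hits a given `z` with conditional probability at most `2 / |α|`: composing
with the transposition of `z` and `z'` injects the extensions with value `z` into those with value
`z'`, for every `z'` outside `V`, hence for at least half of all points. -/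
lemma card_extensions_cons_mul_le {D : List (α × α)} {V : Finset α}
    (hV : ∀ d ∈ D, d.2 ∈ V) {q : α} (hq : ∀ d ∈ D, d.1 ≠ q) (z : α)
    (hc : 2 * V.card ≤ Fintype.card α) :
    (extensions ((q, z) :: D)).card * Fintype.card α ≤ 2 * (extensions D).card := by
  by_cases hz : ∃ d ∈ D, d.2 = z
  · obtain ⟨d, hd, rfl⟩ := hz
    have : extensions ((q, d.2) :: D) = ∅ := by
      refine Finset.eq_empty_of_forall_notMem fun τ hτ => ?_
      rw [mem_extensions] at hτ
      have h1 := hτ _ List.mem_cons_self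
      have h2 := hτ d (List.mem_cons_of_mem _ hd)
      exact hq d hd (τ.injective (h2.trans h1.symm))
    simp [this]
  push Not at hz
  have h1 : ∀ z' ∈ Vᶜ, (extensions ((q, z) :: D)).card ≤
      ((extensions D).filter fun τ => τ q = z').card := by
    intro z' hz'
    rw [Finset.mem_compl] at hz'
    refine Finset.card_le_card_of_injOn (fun τ => Equiv.swap z z' * τ) ?_
      fun τ _ τ' _ h => mul_left_cancel h
    intro τ hτ
    have hτ := mem_extensions.1 hτ
    simp only [Finset.coe_filter, Set.mem_ofPred_eq, mem_extensions, Equiv.Perm.mul_apply]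
    refine ⟨fun d hd => ?_, ?_⟩
    · rw [hτ d (List.mem_cons_of_mem _ hd)]
      exact Equiv.swap_apply_of_ne_of_ne (hz d hd) fun h => hz' (h ▸ hV d hd)
    · rw [hτ _ List.mem_cons_self]
      exact Equiv.swap_apply_left _ _
  have h2 : Vᶜ.card * (extensions ((q, z) :: D)).card ≤ (extensions D).card := by
    calc Vᶜ.card * (extensions ((q, z) :: D)).card
        ≤ ∑ z' ∈ Vᶜ, ((extensions D).filter fun τ => τ q = z').card := by
          rw [← smul_eq_mul]
          exact Finset.card_nsmul_le_sum _ _ _ h1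
      _ ≤ ∑ z', ((extensions D).filter fun τ => τ q = z').card :=
          Finset.sum_le_sum_of_subset (Finset.subset_univ _)
      _ = (extensions D).card :=
          (Finset.card_eq_sum_card_fiberwise fun τ _ => Finset.mem_univ (τ q)).symm
  have h3 : Fintype.card α ≤ 2 * Vᶜ.card := by
    rw [Finset.card_compl]
    omega
  calc _ ≤ (extensions ((q, z) :: D)).card * (2 * Vᶜ.card) := Nat.mul_le_mul_left _ h3
    _ = 2 * (Vᶜ.card * (extensions ((q, z) :: D)).card) := by ring
    _ ≤ _ := Nat.mul_le_mul_left 2 h2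

/-- The pair `(a, b)` such that `τ a = b` if and only if `(τ ^ ε) q = z`. -/
def orient (ε : ℤˣ) (p : α × α) : α × α := if ε = 1 then p else p.swap

omit [Fintype α] [DecidableEq α] in
lemma apply_orient (ε : ℤˣ) (τ : Equiv.Perm α) (q z : α) :
    τ (orient ε (q, z)).1 = (orient ε (q, z)).2 ↔ (τ ^ (ε : ℤ)) q = z := by
  rcases Int.units_eq_one_or ε with rfl | rfl
  · simp [orient]
  · simp only [orient, Units.val_neg, Units.val_one, zpow_neg, zpow_one, Equiv.Perm.inv_eq_iff_eq]
    simp [eq_comm]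

lemma card_extensions_orient_mul_le (ε : ℤˣ) {D : List (α × α)} {V : Finset α}
    (hV : ∀ d ∈ D, d.1 ∈ V ∧ d.2 ∈ V) {q : α} (hq : ∀ d ∈ D, (orient ε d).1 ≠ q) (z : α)
    (hc : 2 * V.card ≤ Fintype.card α) :
    (extensions (orient ε (q, z) :: D)).card * Fintype.card α ≤ 2 * (extensions D).card := by
  rcases Int.units_eq_one_or ε with rfl | rfl
  · exact card_extensions_cons_mul_le (fun d hd => (hV d hd).2) (by simpa [orient] using hq) z hc
  · rw [← card_extensions_swap, ← card_extensions_swap D, List.map_cons]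
    refine card_extensions_cons_mul_le (V := V) ?_ ?_ z hc
    · intro d hd
      obtain ⟨e, he, rfl⟩ := List.mem_map.1 hd
      exact (hV e he).1
    · intro d hd
      obtain ⟨e, he, rfl⟩ := List.mem_map.1 hd
      simpa [orient] using hq e he

lemma sum_card_extensions (ε : ℤˣ) (D : List (α × α)) (q : α) :
    ∑ z, (extensions (orient ε (q, z) :: D)).card = (extensions D).card := by
  rw [Finset.card_eq_sum_card_fiberwise (f := fun τ : Equiv.Perm α => (τ ^ (ε : ℤ)) q)
    (t := Finset.univ) fun τ _ => Finset.mem_univ _]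
  refine Finset.sum_congr rfl fun z _ => ?_
  congr 1
  ext τ
  simp [mem_extensions, apply_orient, and_comm]

/-- The inverse word is read from its first syllable on, exposing one value `z` of `τ ^ (-s.1)` at
`q`. At most `2 * M` values put `z` or its image under `σ ^ (-s.2)` among the known points, each
with probability at most `2 / |α|`; this adds `4 * M` to the bound. For the other values `hgood`
takes over. -/
lemma card_path_step (M : ℕ) (σ : Equiv.Perm α) (p : α) (hM : 2 * M ≤ Fintype.card α)
    (L : List (ℤˣ × ℤ)) (s : ℤˣ × ℤ)
    (D : List (α × α)) (V : Finset α) (hV : ∀ d ∈ D, d.1 ∈ V ∧ d.2 ∈ V)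
    (hc : V.card + 2 * (L.length + 1) ≤ M) (q : α)
    (hq : ∀ d ∈ D, (orient (-s.1) d).1 ≠ q)
    (hgood : ∀ z, z ∉ insert q V → (σ ^ (-s.2)) z ∉ insert q V →
      ((extensions (orient (-s.1) (q, z) :: D)).filter
        fun τ => (listWord σ τ L)⁻¹ ((σ ^ (-s.2)) z) = p).card * Fintype.card α ≤
          4 * M * L.length * (extensions (orient (-s.1) (q, z) :: D)).card) :
    ((extensions D).filter fun τ => (listWord σ τ (s :: L))⁻¹ q = p).card * Fintype.card α ≤
      4 * M * (L.length + 1) * (extensions D).card := by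
  set T := (extensions D).filter fun τ => (listWord σ τ (s :: L))⁻¹ q = p with hT
  set e : α → Finset (Equiv.Perm α) := fun z => extensions (orient (-s.1) (q, z) :: D) with he
  set B : Finset α := insert q V ∪ (insert q V).image (σ ^ s.2) with hB
  have hBcard : B.card ≤ 2 * M := by
    have h1 := Finset.card_union_le (insert q V) ((insert q V).image (σ ^ s.2))
    have h2 := Finset.card_image_le (s := insert q V) (f := σ ^ s.2)
    have h3 := Finset.card_insert_le q V
    have h4 : B.card ≤ _ := h1
    omega
  have hfib : ∀ z, T.filter (fun τ => (τ ^ ((-s.1 : ℤˣ) : ℤ)) q = z) ⊆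
      (e z).filter fun τ => (listWord σ τ L)⁻¹ ((σ ^ (-s.2)) z) = p := by
    intro z τ hτ
    obtain ⟨h1, h2⟩ := Finset.mem_filter.1 hτ
    obtain ⟨h3, h4⟩ := Finset.mem_filter.1 h1
    refine Finset.mem_filter.2 ⟨mem_extensions.2 fun d hd => ?_, ?_⟩
    · rcases List.mem_cons.1 hd with rfl | hd
      · exact (apply_orient _ _ _ _).2 h2
      · exact mem_extensions.1 h3 d hd
    · rw [← h4, ← h2, listWord_cons, mul_inv_rev, mul_inv_rev, ← zpow_neg, ← zpow_neg,
        Units.val_neg]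
      rfl
  have hz : ∀ z, (T.filter fun τ => (τ ^ ((-s.1 : ℤˣ) : ℤ)) q = z).card * Fintype.card α ≤
      (if z ∈ B then 2 * (extensions D).card else 0) + 4 * M * L.length * (e z).card := by
    intro z
    split_ifs with hzB
    · refine le_trans ?_ (Nat.le_add_right _ _)
      refine le_trans (Nat.mul_le_mul_right _ (Finset.card_le_card
        ((hfib z).trans (Finset.filter_subset _ _)))) ?_
      exact card_extensions_orient_mul_le _ hV hq z (by omega)
    · rw [zero_add]
      rw [hB, Finset.mem_union, not_or] at hzB
      refine le_trans (Nat.mul_le_mul_right _ (Finset.card_le_card (hfib z))) (hgood z hzB.1 ?_)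
      intro h
      exact hzB.2 (Finset.mem_image.2 ⟨_, h, by rw [zpow_neg]; simp⟩)
  rw [Finset.card_eq_sum_card_fiberwise (s := T)
    (f := fun τ : Equiv.Perm α => (τ ^ ((-s.1 : ℤˣ) : ℤ)) q)
    (t := Finset.univ) fun τ _ => Finset.mem_univ _, Finset.sum_mul]
  refine (Finset.sum_le_sum fun z _ => hz z).trans ?_
  rw [Finset.sum_add_distrib, ← Finset.mul_sum, sum_card_extensions, Finset.sum_ite_mem,
    Finset.univ_inter, Finset.sum_const, smul_eq_mul]
  calc B.card * (2 * (extensions D).card) + 4 * M * L.length * (extensions D).card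
      ≤ 2 * M * (2 * (extensions D).card) + 4 * M * L.length * (extensions D).card := by gcongr
    _ = _ := by ring

/-- A reduced path with some prescribed values of `τ` rarely ends at its starting point `p`. -/
lemma card_path_mul_le (M : ℕ) (σ : Equiv.Perm α) (p : α) (hM : 2 * M ≤ Fintype.card α)
    (L : List (ℤˣ × ℤ)) (s : ℤˣ × ℤ) (hL : ReducedList (s :: L))
    (hσ : ∀ t ∈ s :: L, t.2 ≠ 0 → ∀ i, (σ ^ t.2) i ≠ i)
    (D : List (α × α)) (V : Finset α) (hp : p ∈ V) (hV : ∀ d ∈ D, d.1 ∈ V ∧ d.2 ∈ V)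
    (hc : V.card + 2 * (L.length + 1) ≤ M) (q : α)
    (hq : ∀ d ∈ D, (orient (-s.1) d).1 ≠ q) :
    ((extensions D).filter fun τ => (listWord σ τ (s :: L))⁻¹ q = p).card * Fintype.card α ≤
      4 * M * (L.length + 1) * (extensions D).card := by
  induction L generalizing s D V q with
  | nil =>
      refine card_path_step M σ p hM [] s D V hV hc q hq fun z hz hz' => ?_
      rw [Finset.filter_eq_empty_iff.2, Finset.card_empty]
      · simp
      · intro τ _ h
        simp only [listWord_nil, inv_one, Equiv.Perm.one_apply] at h
        rw [h] at hz'
        -- A fresh endpoint cannot be `p`, which is a known point.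
        exact hz' (Finset.mem_insert_of_mem hp)
  | cons s' L ih =>
    refine card_path_step M σ p hM (s' :: L) s D V hV hc q hq fun z hz hz' => ?_
    have hsub : ∀ {v}, v ∈ V → v ∈ insert z (insert q V) := fun hv =>
      Finset.mem_insert_of_mem (Finset.mem_insert_of_mem hv)
    have hchain := List.isChain_cons_cons.1 hL
    refine ih s' hchain.2 (fun t ht => hσ t (List.mem_cons_of_mem _ ht)) _
      (insert z (insert q V)) (hsub hp) ?_ ?_ _ ?_
    · intro d hd
      rcases List.mem_cons.1 hd with rfl | hd
      · unfold orient
        split <;> simp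
      · exact ⟨hsub (hV d hd).1, hsub (hV d hd).2⟩
    · have h1 := Finset.card_insert_le z (insert q V)
      have h2 := Finset.card_insert_le q V
      simp only [List.length_cons] at hc
      omega
    · by_cases ha : s.2 = 0
      · have hs := hchain.1 ha
        intro d hd
        rw [ha, neg_zero, zpow_zero, Equiv.Perm.one_apply, ← hs]
        rcases List.mem_cons.1 hd with rfl | hd
        · intro h
          have : (orient (-s.1) (orient (-s.1) (q, z))).1 = q := by
            unfold orient
            split <;> simp
          rw [this] at h
          exact hz (h ▸ Finset.mem_insert_self _ _)
        · intro h
          apply hz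
          rw [← h]
          refine Finset.mem_insert_of_mem ?_
          unfold orient
          split
          · exact (hV d hd).1
          · exact (hV d hd).2
      -- With nonzero exponent, absence of fixed points moves the path off `z`, hence off all known
      -- points.
      · have hne : (σ ^ (-s.2)) z ≠ z := by
          rw [zpow_neg, Ne, Equiv.Perm.inv_eq_iff_eq]
          exact fun h => hσ s List.mem_cons_self ha z h.symm
        have hnot : (σ ^ (-s.2)) z ∉ insert z (insert q V) := by
          rw [Finset.mem_insert, not_or]
          exact ⟨hne, hz'⟩
        intro d hd h
        apply hnot
        rw [← h]
        rcases List.mem_cons.1 hd with rfl | hd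
        · unfold orient
          split <;> split <;> simp
        · apply hsub
          unfold orient
          split
          · exact (hV d hd).1
          · exact (hV d hd).2

/-- In a finite permutation model, a random value of a nontrivial word has boundedly many fixed
points on average. -/
lemma sum_fixCount_le (σ : Equiv.Perm α) {L : List (ℤˣ × ℤ)} (hne : L ≠ []) (hL : ReducedList L)
    (hσ : ∀ t ∈ L, t.2 ≠ 0 → ∀ i, (σ ^ t.2) i ≠ i)
    (hc : 2 * (1 + 2 * L.length) ≤ Fintype.card α) :
    ∑ τ : Equiv.Perm α, fixCount (listWord σ τ L) ≤
      4 * (1 + 2 * L.length) * L.length * Fintype.card (Equiv.Perm α) := by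
  obtain ⟨s, L, rfl⟩ := List.exists_cons_of_ne_nil hne
  have hpos : 0 < Fintype.card α := by omega
  have h1 : ∑ τ : Equiv.Perm α, fixCount (listWord σ τ (s :: L)) =
      ∑ p, (Finset.univ.filter fun τ : Equiv.Perm α => (listWord σ τ (s :: L))⁻¹ p = p).card := by
    simp only [fixCount, Finset.card_filter]
    rw [Finset.sum_comm]
    refine Finset.sum_congr rfl fun p _ => Finset.sum_congr rfl fun τ _ => ?_
    refine if_congr ?_ rfl rfl
    rw [Equiv.Perm.inv_eq_iff_eq, eq_comm]
  have h2 : ∀ p, (Finset.univ.filter fun τ : Equiv.Perm α =>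
      (listWord σ τ (s :: L))⁻¹ p = p).card * Fintype.card α ≤
        4 * (1 + 2 * (s :: L).length) * (s :: L).length * Fintype.card (Equiv.Perm α) := by
    intro p
    have := card_path_mul_le _ σ p hc L s hL hσ [] {p} (by simp) (by simp) (by simp) p (by simp)
    simpa [extensions] using this
  rw [h1]
  refine Nat.le_of_mul_le_mul_right ?_ hpos
  rw [Finset.sum_mul]
  refine (Finset.sum_le_sum fun p _ => h2 p).trans ?_
  rw [Finset.sum_const, Finset.card_univ, smul_eq_mul, mul_comm]

end Count

/-! ### Normal forms in the free group of rank two -/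

/-- Prepending a syllable can fail to be reduced only if `a = 0` and the next sign is opposite. Then
the two letters `y` cancel, and the exponent after them becomes the new prefix. -/
lemma exists_reducedList_mul_left {G : Type} [Group G] (x y : G) (ε : ℤˣ) (a : ℤ)
    {L : List (ℤˣ × ℤ)} (hL : ReducedList L) :
    ∃ (b : ℤ) (M : List (ℤˣ × ℤ)), ReducedList M ∧
      y ^ (ε : ℤ) * (x ^ a * listWord x y L) = x ^ b * listWord x y M := by
  by_cases h : ReducedList ((ε, a) :: L)
  · exact ⟨0, _, h, by simp [mul_assoc]⟩
  · cases L with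
    | nil => exact absurd (List.isChain_singleton _) h
    | cons s L =>
      have h' : ¬ (a = 0 → ε = s.1) := fun h' => h (List.isChain_cons_cons.2 ⟨h', hL⟩)
      push Not at h'
      obtain ⟨rfl, hne⟩ := h'
      have hs : ε = -s.1 := by
        rcases Int.units_eq_one_or ε with rfl | rfl <;>
          rcases Int.units_eq_one_or s.1 with h1 | h1 <;> rw [h1] at hne ⊢ <;> simp at hne ⊢
      exact ⟨s.2, L, hL.of_cons, by simp [hs, mul_assoc]⟩

lemma exists_reducedList (w : FreeGroup (Fin 2)) :
    ∃ (a : ℤ) (L : List (ℤˣ × ℤ)), ReducedList L ∧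
      w = FreeGroup.of 0 ^ a * listWord (FreeGroup.of 0) (FreeGroup.of 1) L := by
  obtain ⟨l, rfl⟩ : ∃ l, FreeGroup.mk l = w := ⟨w.toWord, FreeGroup.mk_toWord⟩
  induction l with
  | nil => exact ⟨0, [], List.isChain_nil, by simp; rfl⟩
  | cons p l ih =>
    obtain ⟨a, L, hL, h⟩ := ih
    obtain ⟨i, b⟩ := p
    have hcons : FreeGroup.mk ((i, b) :: l) =
        FreeGroup.of i ^ ((if b then 1 else -1 : ℤˣ) : ℤ) * FreeGroup.mk l := by
      cases b
      · simp [FreeGroup.of, FreeGroup.inv_mk, FreeGroup.mul_mk, FreeGroup.invRev]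
      · simp [FreeGroup.of, FreeGroup.mul_mk]
    rw [hcons, h]
    obtain rfl | rfl : i = 0 ∨ i = 1 := by fin_cases i <;> simp
    · exact ⟨_, L, hL, by rw [← mul_assoc, ← zpow_add]⟩
    · exact exists_reducedList_mul_left _ _ _ a hL

/-- Outside of `⟨x⟩`, every double coset of `⟨x⟩` contains a cyclically reduced word. -/
lemma exists_cycReducedList {w : FreeGroup (Fin 2)}
    (hw : w ∉ Subgroup.zpowers (FreeGroup.of (0 : Fin 2))) :
    ∃ (a b : ℤ) (L : List (ℤˣ × ℤ)), L ≠ [] ∧ CycReducedList L ∧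
      w = FreeGroup.of 0 ^ a * listWord (FreeGroup.of 0) (FreeGroup.of 1) L *
        FreeGroup.of 0 ^ b := by
  obtain ⟨a, L, hL, h⟩ := exists_reducedList w
  rcases List.eq_nil_or_concat L with rfl | ⟨L, ⟨ε, b⟩, rfl⟩
  · exact absurd ⟨a, by simp [h]⟩ hw
  · rw [List.concat_eq_append] at h hL
    -- The last exponent `b` may vanish, so it is split as `1 + (b - 1)`, with the second part moved
    -- into the right factor.
    refine ⟨a, b - 1, L ++ [(ε, 1)], by simp, ⟨?_, by simp⟩, ?_⟩
    · have := List.isChain_append.1 hL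
      refine List.isChain_append.2 ⟨this.1, List.isChain_singleton _, fun s hs t ht h0 => ?_⟩
      have h2 := this.2.2 s hs (ε, b) (by simp) h0
      simp only [List.head?_cons, Option.mem_some_iff] at ht
      rw [← ht]
      exact h2
    · rw [h, listWord_append, listWord_append]
      simp [mul_assoc, mul_self_zpow]

/-! ### Regularity -/

section Regular

variable {n : ℕ}

lemma substFirst_listWord {G : Type} [Group G] (σ : G) (L : List (ℤˣ × ℤ)) :
    substFirst (listWord (FreeGroup.of 0) (FreeGroup.of 1) L) σ =
      listWord (Monoid.Coprod.inl σ) (Monoid.Coprod.inr (FreeGroup.of 0)) L := by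
  rw [substFirst, map_listWord]
  simp

/-- The expression of the word with constants that is obtained by substituting a group element for
the first letter. -/
def listExpression {G : Type} [Group G] (σ : G) (L : List (ℤˣ × ℤ)) : Expression G 1 :=
  ⟨1, L.map fun s => ⟨0, s.1, σ ^ s.2⟩⟩

lemma listExpression_toWord {G : Type} [Group G] (σ : G) (L : List (ℤˣ × ℤ)) :
    (listExpression σ L).toWord =
      listWord (Monoid.Coprod.inl σ) (Monoid.Coprod.inr (FreeGroup.of 0)) L := by
  simp [listExpression, Expression.toWord, listWord, Syllable.toWord, Function.comp_def]

lemma listExpression_isCritical {G : Type} [Group G] {σ : G} {L : List (ℤˣ × ℤ)}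
    (hL : ReducedList L) {c : G} (hc : (listExpression σ L).IsCritical c) :
    ∃ s ∈ L, s.2 ≠ 0 ∧ c = σ ^ s.2 := by
  obtain ⟨j, hj, -, h2, rfl⟩ := hc
  simp only [listExpression, List.length_map] at hj
  simp only [listExpression, List.getElem_map] at h2 ⊢
  refine ⟨L[j], List.getElem_mem _, fun h0 => ?_, rfl⟩
  have := List.isChain_iff_getElem.1 hL j hj h0
  rw [this] at h2
  rcases Int.units_eq_one_or L[j + 1].1 with h | h <;> rw [h] at h2 <;> simp at h2

/-- A transposition of `c i` with a third point fixes `i` but moves `c i`, so it does not commute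
with `c`. -/
lemma notMem_center_of_fixedPointFree (hn : 3 ≤ n) {c : Equiv.Perm (Fin n)}
    (hc : ∀ i, c i ≠ i) : c ∉ Subgroup.center (Equiv.Perm (Fin n)) := by
  intro h
  let i : Fin n := ⟨0, by omega⟩
  obtain ⟨k, hk⟩ : ∃ k, k ∉ ({i, c i} : Finset (Fin n)) := by
    by_contra! hall
    have h1 := Finset.card_le_card (fun k _ => hall k : (Finset.univ : Finset (Fin n)) ⊆ _)
    have h2 := Finset.card_le_two (a := i) (b := c i)
    rw [Finset.card_univ, Fintype.card_fin] at h1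
    omega
  simp only [Finset.mem_insert, Finset.mem_singleton, not_or] at hk
  have h1 := congrArg (fun π => π i) (Subgroup.mem_center_iff.1 h (Equiv.swap (c i) k))
  simp only [Equiv.Perm.mul_apply, Equiv.swap_apply_left] at h1
  rw [Equiv.swap_apply_of_ne_of_ne (hc i).symm (Ne.symm hk.1)] at h1
  exact hk.2 h1

/-- A word conjugate to `c` becomes trivial when raised to the order of `c`. That power is still a
nonempty reduced list, and in a large enough permutation model the fixed point count forbids it from
being identically trivial. -/
lemma listWord_ne_isConj_const (hn : 0 < n) {σ : Equiv.Perm (Fin n)} {L : List (ℤˣ × ℤ)}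
    (hne : L ≠ []) (hL : CycReducedList L)
    (hσ : ∀ t ∈ L, t.2 ≠ 0 → ∀ i, (σ ^ t.2) i ≠ i) (c : Equiv.Perm (Fin n)) :
    ¬ IsConj (listWord (Monoid.Coprod.inl σ) (Monoid.Coprod.inr (FreeGroup.of (0 : Fin 1))) L)
      (Monoid.Coprod.inl c) := by
  intro hconj
  have hN := orderOf_pos c
  set N := orderOf c
  have h1 : listWord (Monoid.Coprod.inl σ)
      (Monoid.Coprod.inr (FreeGroup.of (0 : Fin 1))) (List.replicate N L).flatten = 1 := by
    rw [listWord_flatten_replicate]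
    have := hconj.pow N
    rwa [← map_pow, pow_orderOf_eq_one, map_one, isConj_one_left] at this
  set L' := (List.replicate N L).flatten with hL'
  have hmem : ∀ t ∈ L', t ∈ L := by
    intro t ht
    obtain ⟨l, hl, htl⟩ := List.mem_flatten.1 ht
    rwa [List.eq_of_mem_replicate hl] at htl
  have hne' : L' ≠ [] := by
    obtain ⟨s, L, rfl⟩ := List.exists_cons_of_ne_nil hne
    obtain ⟨k, hk⟩ := Nat.exists_eq_succ_of_ne_zero hN.ne'
    rw [hL', hk, List.replicate_succ]
    simp
  -- The first summand is the bound on the average number of fixed points; the second makes the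
  -- counting lemma applicable and the comparison strict.
  set M := 4 * (1 + 2 * L'.length) * L'.length + 2 * (1 + 2 * L'.length) with hM
  -- The constants act on `M` copies of the `n` points, which enlarges the model and keeps their
  -- powers free of fixed points.
  let f : Equiv.Perm (Fin n) →* Equiv.Perm (Fin n × Fin M) :=
    { toFun := fun π => Equiv.prodCongr π (Equiv.refl _)
      map_one' := rfl
      map_mul' := fun _ _ => rfl }
  have hcard : M ≤ Fintype.card (Fin n × Fin M) := by
    rw [Fintype.card_prod, Fintype.card_fin, Fintype.card_fin]
    exact Nat.le_mul_of_pos_left M hn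
  have h2 := sum_fixCount_le (f σ) hne' (hL.flatten_replicate N) (fun t ht h0 i h => by
    rw [← map_zpow] at h
    exact hσ t (hmem t ht) h0 i.1 (congrArg Prod.fst h)) (by omega)
  have h3 : ∀ τ : Equiv.Perm (Fin n × Fin M), listWord (f σ) τ L' = 1 := by
    intro τ
    have := congrArg (Monoid.Coprod.lift f (FreeGroup.lift fun _ => τ)) h1
    rw [map_listWord, map_one] at this
    simpa using this
  have h4 : fixCount (1 : Equiv.Perm (Fin n × Fin M)) = Fintype.card (Fin n × Fin M) := by
    simp [fixCount]
  simp only [h3, h4, Finset.sum_const, Finset.card_univ, smul_eq_mul] at h2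
  rw [mul_comm] at h2
  have h5 := Nat.le_of_mul_le_mul_right h2 Fintype.card_pos
  omega

lemma isRegularWord_substFirst (hn : 3 ≤ n) {σ : Equiv.Perm (Fin n)} {L : List (ℤˣ × ℤ)}
    (hne : L ≠ []) (hL : CycReducedList L)
    (hσ : ∀ t ∈ L, t.2 ≠ 0 → ∀ i, (σ ^ t.2) i ≠ i) :
    IsRegularWord (substFirst (listWord (FreeGroup.of 0) (FreeGroup.of 1) L) σ) := by
  rw [substFirst_listWord]
  have hcrit : ∀ c, (listExpression σ (L ++ L)).IsCritical c → ∀ i, c i ≠ i := by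
    intro c hc
    obtain ⟨s, hs, h0, rfl⟩ := listExpression_isCritical (hL.append hL.1) hc
    exact hσ s (by simpa using hs) h0
  refine ⟨fun ⟨c, hc⟩ => listWord_ne_isConj_const (by omega) hne hL hσ c hc,
    listExpression σ (L ++ L), fun c hc => notMem_center_of_fixedPointFree hn (hcrit c hc), ?_,
    hcrit⟩
  rw [listExpression_toWord, listWord_append, sq]

lemma lengthLE_substFirst (hn : 3 ≤ n) {σ : Equiv.Perm (Fin n)} {L : List (ℤˣ × ℤ)}
    (hL : ReducedList L) (hσ : ∀ t ∈ L, t.2 ≠ 0 → ∀ i, (σ ^ t.2) i ≠ i) :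
    LengthLE (substFirst (listWord (FreeGroup.of 0) (FreeGroup.of 1) L) σ) L.length := by
  refine ⟨listExpression σ L, fun c hc => notMem_center_of_fixedPointFree hn ?_, ?_, ?_⟩
  · obtain ⟨s, hs, h0, rfl⟩ := listExpression_isCritical hL hc
    exact hσ s hs h0
  · rw [listExpression_toWord, substFirst_listWord]
  · simp [Expression.length, listExpression]

/-- Filler for the small `n`, since the full conjecture asks for regularity at every `n`. The
exponent sum separates the variable from constants. -/
lemma isRegularWord_variable :
    IsRegularWord (n := n) (r := 1) (Monoid.Coprod.inr (FreeGroup.of 0)) := by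
  refine ⟨?_, ⟨1, [⟨0, 1, 1⟩, ⟨0, 1, 1⟩]⟩, ?_, ?_, ?_⟩
  · rintro ⟨c, hc⟩
    have h := (Monoid.Coprod.lift (1 : Equiv.Perm (Fin n) →* Multiplicative ℤ)
      (FreeGroup.lift fun _ : Fin 1 => Multiplicative.ofAdd 1)).map_isConj hc
    rw [isConj_iff_eq] at h
    simp at h
  · rintro c ⟨j, hj, -, h, -⟩
    obtain rfl : j = 0 := by simpa using hj
    simp at h
  · simp [Expression.toWord, Syllable.toWord, sq]
  · rintro c ⟨j, hj, -, h, -⟩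
    obtain rfl : j = 0 := by simpa using hj
    simp at h

lemma lengthLE_variable :
    LengthLE (r := 1) (G := Equiv.Perm (Fin n)) (Monoid.Coprod.inr (FreeGroup.of 0)) 1 := by
  refine ⟨⟨1, [⟨0, 1, 1⟩]⟩, ?_, ?_, ?_⟩
  · rintro c ⟨j, hj, -⟩
    simp at hj
  · simp [Expression.toWord, Syllable.toWord]
  · simp [Expression.length]

lemma eventually_cycle_zpow_fixedPointFree (L : List (ℤˣ × ℤ)) :
    ∀ᶠ n : ℕ in atTop, ∀ σ : Equiv.Perm (Fin n), σ.IsCycleOn Set.univ →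
      ∀ t ∈ L, t.2 ≠ 0 → ∀ i, (σ ^ t.2) i ≠ i := by
  have : ∀ᶠ n : ℕ in atTop, ∀ t ∈ L, t.2.natAbs < n := by
    induction L with
    | nil => simp
    | cons s L ih =>
      filter_upwards [ih, eventually_gt_atTop s.2.natAbs] with n h1 h2
      simpa using ⟨h2, fun a b hab => h1 (a, b) hab⟩
  filter_upwards [this] with n hn σ hσ t ht h0 i h
  have hσ' : σ.IsCycleOn ((Finset.univ : Finset (Fin n)) : Set (Fin n)) := by simpa using hσ
  rw [hσ'.zpow_apply_eq (Finset.mem_univ i), Finset.card_univ, Fintype.card_fin] at h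
  have h1 := Nat.le_of_dvd (Int.natAbs_pos.2 h0) (Int.natCast_dvd.1 h)
  exact absurd (hn t ht) (by omega)

end Regular

/-! ### Word values at a full cycle -/

/-- The distribution of the values of the word of a list at a fixed first letter. -/
def listValues {G : Type} [Group G] [Fintype G] (σ : G) (L : List (ℤˣ × ℤ)) : PMF G :=
  (PMF.uniformOfFintype G).map fun τ => listWord σ τ L

lemma wordValues_substFirst {G : Type} [Group G] [Fintype G] (σ : G) (L : List (ℤˣ × ℤ)) :
    wordValues (substFirst (listWord (FreeGroup.of 0) (FreeGroup.of 1) L) σ) =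
      listValues σ L := by
  rw [substFirst_listWord, wordValues, listValues,
    ← uniformOfFintype_map_equiv (Equiv.funUnique (Fin 1) G), PMF.map_comp]
  congr 1
  funext g
  simp [evalAt, map_listWord]

/-- This makes the uniform measure an instance of the estimates for cyclically reduced words. -/
lemma listValues_singleton {G : Type} [Group G] [Fintype G] (σ : G) :
    listValues σ [(1, 1)] = PMF.uniformOfFintype G := by
  refine Eq.trans ?_ (uniformOfFintype_map_equiv (Equiv.mulRight σ))
  unfold listValues
  simp only [listWord_cons, listWord_nil, Units.val_one, zpow_one, mul_one]
  rfl

lemma cycReducedList_singleton : CycReducedList [(1, 1)] :=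
  ⟨List.isChain_singleton _, by simp⟩

/-- Powers of a value are values of the repeated list, which is reduced because `L` is cyclically
reduced. The constant depends on neither `n` nor the cycle. -/
lemma eventually_mean_fixCount_le {L : List (ℤˣ × ℤ)} (hne : L ≠ []) (hL : CycReducedList L)
    (k : ℕ) : ∃ C : ℝ, ∀ᶠ n : ℕ in atTop, ∀ σ : Equiv.Perm (Fin n), σ.IsCycleOn Set.univ →
      mean (listValues σ L) (fun π => (fixCount (π ^ (k + 1)) : ℝ)) ≤ C := by
  set L' := (List.replicate (k + 1) L).flatten with hL'
  have hmem : ∀ t ∈ L', t ∈ L := by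
    intro t ht
    obtain ⟨l, hl, htl⟩ := List.mem_flatten.1 ht
    rwa [List.eq_of_mem_replicate hl] at htl
  have hne' : L' ≠ [] := by
    rw [hL', List.replicate_succ]
    simp [hne]
  refine ⟨(4 * (1 + 2 * L'.length) * L'.length : ℕ), ?_⟩
  filter_upwards [eventually_cycle_zpow_fixedPointFree L,
    eventually_ge_atTop (2 * (1 + 2 * L'.length))] with n h1 h2 σ hσ
  have h := sum_fixCount_le σ hne' (hL.flatten_replicate _) (fun t ht => h1 σ hσ t (hmem t ht))
    (by simpa using h2)
  rw [listValues, mean_map, mean_uniform, div_le_iff₀ (by exact_mod_cast Fintype.card_pos)]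
  simp only [← listWord_flatten_replicate]
  exact_mod_cast h

lemma eventually_cycle_defect_le {L : List (ℤˣ × ℤ)} (hne : L ≠ []) (hL : CycReducedList L)
    {K : ℕ} {ε : ℝ} (hK : 2 / K < ε) :
    ∀ᶠ n : ℕ in atTop, ∀ σ : Equiv.Perm (Fin n), σ.IsCycleOn Set.univ →
      2 / K + 2 / n * ∑ k ∈ Finset.range K,
        mean (listValues σ L) (fun π => (fixCount (π ^ (k + 1)) : ℝ)) ≤ ε := by
  choose C hC using eventually_mean_fixCount_le hne hL
  have hC' : ∀ᶠ n : ℕ in atTop, ∀ k ∈ Finset.range K, ∀ σ : Equiv.Perm (Fin n),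
      σ.IsCycleOn Set.univ →
        mean (listValues σ L) (fun π => (fixCount (π ^ (k + 1)) : ℝ)) ≤ C k :=
    (Filter.eventually_all_finset _).2 fun k _ => hC k
  have hlim : Tendsto (fun n : ℕ => (2 : ℝ) / n * ∑ k ∈ Finset.range K, C k) atTop (𝓝 0) := by
    simpa using (tendsto_const_div_atTop_nhds_zero_nat (2 : ℝ)).mul_const
      (∑ k ∈ Finset.range K, C k)
  filter_upwards [hC', hlim.eventually_lt_const (sub_pos.2 hK)] with n h1 h2 σ hσ
  have : (2 : ℝ) / n * ∑ k ∈ Finset.range K,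
      mean (listValues σ L) (fun π => (fixCount (π ^ (k + 1)) : ℝ)) ≤
        2 / n * ∑ k ∈ Finset.range K, C k := by
    gcongr with k hk
    exact h1 k hk σ hσ
  linarith

lemma exists_two_div_lt {ε : ℝ} (hε : 0 < ε) : ∃ K : ℕ, 0 < K ∧ 2 / (K : ℝ) < ε := by
  obtain ⟨K, hK, hK'⟩ := (((tendsto_const_div_atTop_nhds_zero_nat (2 : ℝ)).eventually_lt_const
    hε).and (eventually_gt_atTop 0)).exists
  exact ⟨K, hK', hK⟩

/-- The average over conjugations of the distribution of word values at a full cycle is close to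
the uniform distribution. -/
lemma eventually_hasCoupling_conjAverage {L : List (ℤˣ × ℤ)} (hne : L ≠ [])
    (hL : CycReducedList L) {ε : ℝ} (hε : 0 < ε) :
    ∀ᶠ n : ℕ in atTop, ∀ σ : Equiv.Perm (Fin n), σ.IsCycleOn Set.univ →
      HasCoupling hamming (conjAverage (listValues σ L)) (PMF.uniformOfFintype _) ε := by
  obtain ⟨K, hK, hK'⟩ := exists_two_div_lt (half_pos hε)
  filter_upwards [eventually_cycle_defect_le hne hL hK',
    eventually_cycle_defect_le (by simp) cycReducedList_singleton hK',
    eventually_gt_atTop 0] with n h1 h2 hn σ hσ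
  have c1 := (hasCoupling_conjAverage_cycle hn hK (listValues σ L) hσ).mono (h1 σ hσ)
  have c2 := (hasCoupling_conjAverage_cycle hn hK (listValues σ [(1, 1)]) hσ).mono (h2 σ hσ)
  rw [listValues_singleton, conjAverage_uniform] at c2
  exact (c1.trans hamming_triangle (c2.symm hamming_comm)).mono (add_halves ε).le

/-- Asymptotic conjugation invariance along all sequences of full cycles makes the distribution of
word values uniformly close to the uniform distribution. -/
lemma eventually_hasCoupling_uniform {L : List (ℤˣ × ℤ)} (hne : L ≠ []) (hL : CycReducedList L)
    (hinv : ∀ σ : (n : ℕ) → Equiv.Perm (Fin n), (∀ n, (σ n).IsCycleOn Set.univ) →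
      AsympConjInvariant fun n =>
        substFirst (listWord (FreeGroup.of 0) (FreeGroup.of 1) L) (σ n))
    {ε : ℝ} (hε : 0 < ε) :
    ∀ᶠ n : ℕ in atTop, ∀ σ : Equiv.Perm (Fin n), σ.IsCycleOn Set.univ →
      HasCoupling hamming (listValues σ L) (PMF.uniformOfFintype _) ε := by
  -- Choosing a worst full cycle for each `n` lets convergence along one sequence control all full
  -- cycles at once.
  have hworst : ∀ n, ∃ σ : Equiv.Perm (Fin n), σ.IsCycleOn Set.univ ∧
      ∀ σ' : Equiv.Perm (Fin n), σ'.IsCycleOn Set.univ →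
        krDist hamming (conjAverage (listValues σ' L)) (listValues σ' L) ≤
          krDist hamming (conjAverage (listValues σ L)) (listValues σ L) := by
    intro n
    obtain ⟨ζ, hζ⟩ := exists_isCycleOn_univ n
    obtain ⟨σ, hσ, h⟩ := Set.exists_max_image {σ : Equiv.Perm (Fin n) | σ.IsCycleOn Set.univ}
      (fun σ => krDist hamming (conjAverage (listValues σ L)) (listValues σ L))
      (Set.toFinite _) ⟨ζ, hζ⟩
    exact ⟨σ, hσ, h⟩
  choose σ hσ hmax using hworst
  have hlim := hinv σ hσ
  simp only [AsympConjInvariant, wordValues_substFirst] at hlim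
  filter_upwards [hlim.eventually_lt_const (half_pos hε),
    eventually_hasCoupling_conjAverage hne hL (half_pos hε)] with n h1 h2 σ' hσ'
  have c1 : HasCoupling hamming (conjAverage (listValues σ' L)) (listValues σ' L) (ε / 2) :=
    hasCoupling_of_krDist_lt ((hmax n σ' hσ').trans_lt h1)
  exact ((c1.symm hamming_comm).trans hamming_triangle (h2 σ' hσ')).mono (add_halves ε).le

/-! ### Simultaneous equidistribution -/

/-- Word maps are Lipschitz in the first letter. -/
lemma exists_hamming_lift_le (w : FreeGroup (Fin 2)) :
    ∃ C : ℝ, 0 ≤ C ∧ ∀ (n : ℕ) (σ σ' τ : Equiv.Perm (Fin n)),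
      hamming (FreeGroup.lift ![σ, τ] w) (FreeGroup.lift ![σ', τ] w) ≤ C * hamming σ σ' := by
  induction w using FreeGroup.induction_on with
  | C1 => exact ⟨0, le_rfl, fun n σ σ' τ => by simp [hamming_self]⟩
  | of i =>
    refine ⟨1, zero_le_one, fun n σ σ' τ => ?_⟩
    obtain rfl | rfl : i = 0 ∨ i = 1 := by fin_cases i <;> simp
    · simp
    · simp [hamming_self, hamming_nonneg]
  | inv_of i h =>
    obtain ⟨C, hC, h⟩ := h
    exact ⟨C, hC, fun n σ σ' τ => by simpa only [map_inv, hamming_inv] using h n σ σ' τ⟩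
  | mul u v hu hv =>
    obtain ⟨C, hC, hu⟩ := hu
    obtain ⟨D, hD, hv⟩ := hv
    refine ⟨C + D, add_nonneg hC hD, fun n σ σ' τ => ?_⟩
    rw [map_mul, map_mul, add_mul]
    exact (hamming_mul_le _ _ _ _).trans (add_le_add (hu n σ σ' τ) (hv n σ σ' τ))

lemma hammingTuple_pair {n : ℕ} (σ ρ ρ' : Equiv.Perm (Fin n)) :
    hammingTuple ![σ, ρ] ![σ, ρ'] = hamming ρ ρ' := by
  simp [hammingTuple, hamming_self]

lemma uniformOfFintype_pair (G : Type) [Group G] [Fintype G] {β : Type} (f : (Fin 2 → G) → β) :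
    (PMF.uniformOfFintype (Fin 2 → G)).map f =
      (PMF.uniformOfFintype G).bind fun σ => (PMF.uniformOfFintype G).map fun τ => f ![σ, τ] := by
  rw [← uniformOfFintype_map_equiv (finTwoArrowEquiv G).symm, uniformOfFintype_prod, PMF.map_bind,
    PMF.map_bind]
  simp only [PMF.map_comp]
  rfl

lemma tendsto_zero_of_eventually_le {f : ℕ → ℝ} (hf : ∀ n, 0 ≤ f n)
    (h : ∀ ε > 0, ∀ᶠ n in atTop, f n ≤ ε) : Tendsto f atTop (𝓝 0) := by
  refine tendsto_order.2 ⟨fun a ha => Eventually.of_forall fun n => ha.trans_le (hf n),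
    fun a ha => ?_⟩
  filter_upwards [h (a / 2) (half_pos ha)] with n hn
  linarith

lemma isSAE_of_asympConjInvariant
    (hinv : ∀ L : List (ℤˣ × ℤ), L ≠ [] → CycReducedList L →
      ∀ σ : (n : ℕ) → Equiv.Perm (Fin n), (∀ n, (σ n).IsCycleOn Set.univ) →
        AsympConjInvariant fun n =>
          substFirst (listWord (FreeGroup.of 0) (FreeGroup.of 1) L) (σ n))
    {w : FreeGroup (Fin 2)} (hw : w ∉ Subgroup.zpowers (FreeGroup.of (0 : Fin 2))) :
    IsSAE ![FreeGroup.of 0, w] := by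
  obtain ⟨a, b, L, hne, hL, hwL⟩ := exists_cycReducedList hw
  obtain ⟨C, hC, hlip⟩ := exists_hamming_lift_le w
  have hnonneg : ∀ {n d : ℕ} (σ τ : Fin d → Equiv.Perm (Fin n)), 0 ≤ hammingTuple σ τ :=
    fun σ τ => Finset.sum_nonneg fun i _ => hamming_nonneg _ _
  refine tendsto_zero_of_eventually_le (fun n => krDist_nonneg hnonneg _ _) fun ε hε => ?_
  -- Replacing `σ` by a full cycle costs `C` times this amount, and equidistribution at the cycle
  -- costs it once more.
  have hδ : 0 < ε / (C + 1) := by positivity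
  obtain ⟨K, hK, hK'⟩ := exists_two_div_lt hδ
  filter_upwards [eventually_hasCoupling_uniform hne hL (hinv L hne hL) hδ,
    eventually_cycle_defect_le (by simp) cycReducedList_singleton hK',
    eventually_gt_atTop 0] with n h1 h2 hn
  choose c hc hd using exists_isCycleOn_univ_hamming_le (n := n) hn hK
  refine HasCoupling.krDist_le hnonneg ?_
  have hcycle : ∀ σ : Equiv.Perm (Fin n), σ.IsCycleOn Set.univ →
      HasCoupling hamming ((PMF.uniformOfFintype (Equiv.Perm (Fin n))).map
        fun τ => FreeGroup.lift ![σ, τ] w) (PMF.uniformOfFintype _) (ε / (C + 1)) := by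
    intro σ hσ
    have := (h1 σ hσ).map (d' := hamming) (fun ρ => σ ^ a * ρ * σ ^ b)
      fun ρ ρ' => by rw [hamming_mul_right, hamming_mul_left]
    have hU := uniformOfFintype_map_equiv ((Equiv.mulLeft (σ ^ a)).trans (Equiv.mulRight (σ ^ b)))
    change (PMF.uniformOfFintype _).map (fun ρ => σ ^ a * ρ * σ ^ b) = _ at hU
    rw [hU, listValues, PMF.map_comp] at this
    have hfun : (fun τ => FreeGroup.lift ![σ, τ] w) =
        (fun ρ => σ ^ a * ρ * σ ^ b) ∘ fun τ => listWord σ τ L := by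
      funext τ
      rw [hwL]
      simp [map_listWord]
    rw [hfun]
    exact this
  -- Conditionally on `σ`, the first coordinates agree, so only the second coordinate contributes to
  -- the cost.
  have hall : ∀ σ : Equiv.Perm (Fin n), HasCoupling hammingTuple
      ((PMF.uniformOfFintype (Equiv.Perm (Fin n))).map fun τ =>
        (fun g i => FreeGroup.lift g ((![FreeGroup.of 0, w] : Fin 2 → _) i)) ![σ, τ])
      ((PMF.uniformOfFintype (Equiv.Perm (Fin n))).map fun τ => id ![σ, τ])
      (C * hamming σ (c σ) + ε / (C + 1)) := by
    intro σ
    have c1 : HasCoupling hamming ((PMF.uniformOfFintype (Equiv.Perm (Fin n))).map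
        fun τ => FreeGroup.lift ![σ, τ] w) _ _ :=
      HasCoupling.map_map _ hamming _ (fun τ => FreeGroup.lift ![c σ, τ] w)
        fun τ => hlip n σ (c σ) τ
    have := (c1.trans hamming_triangle (hcycle _ (hc σ))).map (d' := hammingTuple)
      (fun ρ => ![σ, ρ]) fun ρ ρ' => (hammingTuple_pair σ ρ ρ').le
    rw [PMF.map_comp] at this
    have hfun : (fun τ => (fun g i =>
        FreeGroup.lift g ((![FreeGroup.of 0, w] : Fin 2 → _) i)) ![σ, τ]) =
        (fun ρ => ![σ, ρ]) ∘ fun τ => FreeGroup.lift ![σ, τ] w := by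
      funext τ i
      obtain rfl | rfl : i = 0 ∨ i = 1 := by fin_cases i <;> simp
      · simp
      · simp
    rw [hfun]
    exact this
  have hbind := HasCoupling.bind (PMF.uniformOfFintype (Equiv.Perm (Fin n))) _ _ _ _ hall
  rw [← uniformOfFintype_pair _ fun g i => FreeGroup.lift g ((![FreeGroup.of 0, w] : Fin 2 → _) i),
    ← uniformOfFintype_pair, PMF.map_id] at hbind
  refine hbind.mono ?_
  rw [mean_add, mean_const, mean_const_mul]
  -- Any full cycle serves here: the values of `yx` are uniform whatever the first letter is.
  obtain ⟨ζ, hζ⟩ := exists_isCycleOn_univ n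
  have h3 := h2 ζ hζ
  rw [listValues_singleton] at h3
  have h4 : mean (PMF.uniformOfFintype (Equiv.Perm (Fin n))) (fun σ => hamming σ (c σ)) ≤
      ε / (C + 1) := by
    refine (mean_mono _ hd).trans ?_
    rwa [mean_add, mean_const, mean_const_mul, mean_sum]
  calc _ ≤ C * (ε / (C + 1)) + ε / (C + 1) := by gcongr
    _ = ε := by field_simp

/-- The conjecture at long cycles is a special case of the conjecture. -/
lemma asympConjInvariant_of_conjecture (h : ConjInvarianceConjecture) {L : List (ℤˣ × ℤ)}
    (hne : L ≠ []) (hL : CycReducedList L) (σ : (n : ℕ) → Equiv.Perm (Fin n))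
    (hσ : ∀ n, (σ n).IsCycleOn Set.univ) :
    AsympConjInvariant fun n =>
      substFirst (listWord (FreeGroup.of 0) (FreeGroup.of 1) L) (σ n) := by
  obtain ⟨N, hN⟩ := eventually_atTop.1
    ((eventually_cycle_zpow_fixedPointFree L).and (eventually_ge_atTop 3))
  -- The sequence is altered at finitely many `n` so as to be regular throughout, which does not
  -- affect the limit.
  let w : (n : ℕ) → ConstWord (Equiv.Perm (Fin n)) 1 := fun n =>
    if N ≤ n then substFirst (listWord (FreeGroup.of 0) (FreeGroup.of 1) L) (σ n)
    else Monoid.Coprod.inr (FreeGroup.of 0)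
  have hlen : 1 ≤ L.length := List.length_pos_iff.2 hne
  have hw := h 1 w (fun n => by
    by_cases hn : N ≤ n
    · simp only [w, if_pos hn]
      exact isRegularWord_substFirst (hN n hn).2 hne hL ((hN n hn).1 (σ n) (hσ n))
    · simp only [w, if_neg hn]
      exact isRegularWord_variable) ⟨L.length, fun n => by
    by_cases hn : N ≤ n
    · simp only [w, if_pos hn]
      exact lengthLE_substFirst (hN n hn).2 hL.1 ((hN n hn).1 (σ n) (hσ n))
    · simp only [w, if_neg hn]
      obtain ⟨e, h1, h2, h3⟩ := lengthLE_variable (n := n)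
      exact ⟨e, h1, h2, h3.trans hlen⟩⟩
  refine Tendsto.congr' ?_ hw
  filter_upwards [eventually_ge_atTop N] with n hn
  simp only [w, if_pos hn]

lemma asympConjInvariant_of_longCycles (h : ConjInvarianceAtLongCycles) {L : List (ℤˣ × ℤ)}
    (hne : L ≠ []) (hL : CycReducedList L) (σ : (n : ℕ) → Equiv.Perm (Fin n))
    (hσ : ∀ n, (σ n).IsCycleOn Set.univ) :
    AsympConjInvariant fun n =>
      substFirst (listWord (FreeGroup.of 0) (FreeGroup.of 1) L) (σ n) := by
  refine h _ σ hσ ?_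
  filter_upwards [eventually_cycle_zpow_fixedPointFree L, eventually_ge_atTop 3] with n h1 h2
  exact isRegularWord_substFirst h2 hne hL (h1 (σ n) (hσ n))

end WordDist

end

theorem theorem4p8 :
    (WordDist.ConjInvarianceConjecture →
      ∀ w : FreeGroup (Fin 2), w ∉ Subgroup.zpowers (FreeGroup.of (0 : Fin 2)) →
        WordDist.IsSAE ![FreeGroup.of 0, w]) ∧
    (WordDist.ConjInvarianceAtLongCycles →
      ∀ w : FreeGroup (Fin 2), w ∉ Subgroup.zpowers (FreeGroup.of (0 : Fin 2)) →
        WordDist.IsSAE ![FreeGroup.of 0, w]) :=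
  ⟨fun h _ hw => WordDist.isSAE_of_asympConjInvariant
      (fun _ hne hL => WordDist.asympConjInvariant_of_conjecture h hne hL) hw,
    fun h _ hw => WordDist.isSAE_of_asympConjInvariant
      (fun _ hne hL => WordDist.asympConjInvariant_of_longCycles h hne hL) hw⟩
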